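/- Setting. Let $\mathcal S=\{1,\dots,N\}$, $t_{end}>0$, $\pi_0$ a probability vector on $\mathcal S$, and let $\Theta$ be a measurable space with a $\sigma$-finite reference measure $d\theta$. For $\theta\in\Theta$ let $A(\theta)$ be a rate matrix on $\mathcal S$ (nonnegative off-diagonal entries, zero row sums), measurable in $\theta$; write $A_s(\theta)=-A_{ss}(\theta)$. Let $p(\theta)$ be a prior probability density, $q(\vartheta|\theta)$ a (jointly measurable) proposal probability density, and $\Omega:\Theta\to\mathbb R$ a measurable function with $\Omega(\theta)\ge\max_s A_s(\theta)$. Given $\theta$, let $S(t)$, $t\in[0,t_{end}]$, be the Markov jump process with initial distribution $\pi_0$ and rate matrix $A(\theta)$, represented by its jump times and states, $S(t)\equiv(S,T)$. Given $\theta$ and $S(\cdot)$, the observations $X=(x_1,\dots,x_m)$, made at times $\tau_1,\dots,\tau_m\in[0,t_{end}]$, are independent, $x_j$ having density $f_j(\,\cdot\,|\,S(\tau_j),\theta)$. Fix $X$ with $0<P(X)<\infty$, where $P(X)$ is the marginal density of the observations, and let $P(\theta,S(t)|X)$ be the posterior. Notation. For a grid $W=\{w_1<\dots<w_k\}\subset(0,t_{end})$,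 put $w_0=0$ and $$B(\theta,\vartheta)=I+\frac{A(\theta)}{\Omega(\theta)+\Omega(\vartheta)}$$ (read $B(\theta,\vartheta)=I$ if $\Omega(\theta)+\Omega(\vartheta)=0$, when $A(\theta)=0$). Let $L_i(s)$ be the product of the likelihoods under state $s$ and parameter $\theta$ of all observations with times in $[w_i,w_{i+1})$ (for $i=k$: in $[w_k,t_{end}]$), and let $P(X|W,\theta,\vartheta)=\sum_{v_0,\dots,v_k}\pi_0(v_0)\prod_{i<k}B(\theta,\vartheta)_{v_iv_{i+1}}\prod_{i\le k}L_i(v_i)$. Let $P(W|\theta,\vartheta)=(\Omega(\theta)+\Omega(\vartheta))^{|W|}e^{-(\Omega(\theta)+\Omega(\vartheta))t_{end}}$, a density with respect to Lebesgue measure $dW$ on ordered tuples in $(0,t_{end})$ of any length. Sampler. From $(\theta,S(t))$: 1. Draw $\vartheta\sim q(\cdot|\theta)$. Draw $U\subset[0,t_{end}]$ from a Poisson process with rate $\Omega(\theta)+\Omega(\vartheta)-A_{S(t)}(\theta)$, set $W=T\cup U$, and discard the states. 2. By forward passes of the forward–backward algorithm over $W$ compute $P(X|W,\theta,\vartheta)$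 and $P(X|W,\vartheta,\theta)$. Let $(\theta',\vartheta')=(\vartheta,\theta)$ with probability $$\alpha=1\wedge\frac{P(X|W,\vartheta,\theta)\,p(\vartheta)\,q(\theta|\vartheta)}{P(X|W,\theta,\vartheta)\,p(\theta)\,q(\vartheta|\theta)},$$ and $(\theta',\vartheta')=(\theta,\vartheta)$ otherwise. 3. Draw states on $\{0\}\cup W$ by the backward pass for the parameter $\theta'$ and the transition matrix $B(\theta',\vartheta')$, discard self-transitions and $\vartheta'$, and return $(\theta',S'(t))$. (On events of stationary probability zero where a denominator vanishes, the swap is rejected, and a backward-pass distribution that cannot be normalized is replaced by the uniform one.) Proposition. One iteration of the sampler is a Markov kernel on pairs (parameter, trajectory), and it leaves the posterior $P(\theta,S(t)|X)$ invariant. Moreover: (a) for all $\theta,\vartheta$, $P(W|\theta,\vartheta)\,dW$ is the law of a homogeneous Poisson process of rate $\Omega(\theta)+\Omega(\vartheta)$ on $[0,t_{end}]$, and $P(W|\theta,\vartheta)=P(W|\vartheta,\theta)$; (b) if $(\theta,S(t))$ is distributed according to the posterior, then after step 1 the triple $(\theta,\vartheta,W)$ has density $$g(\theta,\vartheta,W)=\frac{p(\theta)\,q(\vartheta|\theta)\,P(W|\theta,\vartheta)\,P(X|W,\theta,\vartheta)}{P(X)}$$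 with respect to $d\theta\,d\vartheta\,dW$; (c) for almost every $(\theta,\vartheta,W)$ under this law, the Metropolis–Hastings acceptance probability $1\wedge g(\vartheta,\theta,W)/g(\theta,\vartheta,W)$ of the swap of $\theta$ and $\vartheta$ equals $\alpha$: the grid density cancels. -/

import Mathlib

open MeasureTheory ProbabilityTheory
open scoped NNReal ENNReal

noncomputable section

namespace SymMH

/-! ### Finite point configurations, grids and trajectories -/

/-- A finite tuple of times, `⟨k, w⟩` with `w : Fin k → ℝ`. It carries the disjoint-union
σ-algebra of the `ℝ^k`. An ordered tuple is a grid. -/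
abbrev Config : Type := Σ k : ℕ, (Fin k → ℝ)

/-- A trajectory `(S, T)` with states in `Fin N`: a number `n` of jumps, the jump times
`t : Fin n → ℝ` and the successive states `s : Fin (n + 1) → Fin N`. -/
abbrev Path (N : ℕ) : Type := Σ n : ℕ, (Fin n → ℝ) × (Fin (n + 1) → Fin N)

/-- Lebesgue measure on every `ℝ^k`. -/
def configRef : Measure Config :=
  Measure.sum fun k : ℕ => (volume : Measure (Fin k → ℝ)).map (fun w => (⟨k, w⟩ : Config))

/-- Lebesgue measure on jump times times counting measure on state sequences, for every `n`. -/
def pathRef (N : ℕ) : Measure (Path N) :=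
  Measure.sum fun n : ℕ =>
    ((volume : Measure (Fin n → ℝ)).prod (Measure.count : Measure (Fin (n + 1) → Fin N))).map
      (fun x => (⟨n, x⟩ : Path N))

/-- `w` lists times of `(0, T)` in strictly increasing order. -/
def IsOrderedIn (T : ℝ) {k : ℕ} (w : Fin k → ℝ) : Prop :=
  StrictMono w ∧ ∀ i, w i ∈ Set.Ioo 0 T

/-- The index `i` of the interval `[w_i, w_{i+1})` that contains `x`, where `w_0 = 0`, the ordered
grid points are `w_1, …, w_k`, and the last interval extends to the end of the time window. -/
def intervalIndex {k : ℕ} (w : Fin k → ℝ) (x : ℝ) : Fin (k + 1) :=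
  ⟨(Finset.univ.filter fun i => w i ≤ x).card,
    Nat.lt_succ_of_le ((Finset.card_le_univ _).trans_eq (Fintype.card_fin k))⟩

/-- The state `S(x)` of the trajectory at time `x` (right-continuous, piecewise constant). -/
def stateAt {N : ℕ} (z : Path N) (x : ℝ) : Fin N :=
  z.2.2 (intervalIndex z.2.1 x)

/-- The set of the entries of a tuple of times. -/
def pts {k : ℕ} (w : Fin k → ℝ) : Finset ℝ := Finset.univ.image w

/-- The elements of a finite set of times, listed in increasing order. -/
def gridOf (F : Finset ℝ) : Config := ⟨F.card, fun i => F.orderEmbOfFin rfl i⟩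

/-- Discard self-transitions: from the states `v_0, …, v_k` on the grid `w_1, …, w_k`, keep the
times at which the state changes and the corresponding states. -/
def thin {N k : ℕ} (w : Fin k → ℝ) (v : Fin (k + 1) → Fin N) : Path N :=
  let I : Finset (Fin k) := Finset.univ.filter fun i => v i.castSucc ≠ v i.succ
  ⟨I.card, fun a => w (I.orderEmbOfFin rfl a),
    Fin.cons (v 0) (fun a => v (I.orderEmbOfFin rfl a).succ)⟩

/-! ### Poisson processes -/

/-- The law of a Poisson process with finite intensity measure `μ` on `ℝ`: the number of points is
Poisson with mean `Λ = μ(ℝ)` and, given that it is `m`, the points are i.i.d. with law `μ / Λ`.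
So the part with `m` points is `e^{-Λ} Λ^m / m! · (μ / Λ)^{⊗ m} = e^{-Λ} / m! · μ^{⊗ m}`. The points
are listed in exchangeable, not in increasing, order. -/
def poissonProcess (μ : Measure ℝ) : Measure Config :=
  Measure.sum fun m : ℕ =>
    (ENNReal.ofReal (Real.exp (-(μ Set.univ).toReal)) / (m.factorial : ℝ≥0∞)) •
      (Measure.pi fun _ : Fin m => μ).map (fun u => (⟨m, u⟩ : Config))

open Classical in
/-- The density `r^{|W|} e^{-rT}` of a rate-`r` Poisson process on `[0, T]` at the ordered grid `W`,
with respect to `configRef`. -/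
def poissonGridDensity (T r : ℝ) (W : Config) : ℝ≥0∞ :=
  if IsOrderedIn T W.2 then ENNReal.ofReal (r ^ W.1 * Real.exp (-(r * T))) else 0

/-! ### Forward filtering and backward sampling for a hidden Markov model -/

/-- The probability vector proportional to `g` (the uniform vector if `g = 0`). -/
def probOf {N : ℕ} (g : Fin N → ℝ≥0) (s : Fin N) : ℝ≥0 :=
  if ∑ s', g s' = 0 then (N : ℝ≥0)⁻¹ else g s / ∑ s', g s'

/-- Forward pass with initial distribution `init`, transition matrix `B` and step-`i` likelihood
`L i`: `forward i s` is the probability of state `s` at step `i` jointly with the observations up to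
and including those of step `i`. -/
def forward {N : ℕ} (init : Fin N → ℝ≥0) (B : Matrix (Fin N) (Fin N) ℝ≥0)
    (L : ℕ → Fin N → ℝ≥0) : ℕ → Fin N → ℝ≥0
  | 0, s => init s * L 0 s
  | i + 1, s => (∑ s', forward init B L i s' * B s' s) * L (i + 1) s

/-- The probability that the backward pass produces the states `v_0, …, v_k`: `v_k` is drawn
from the normalized last forward message, and then, for `i = k-1, …, 0`, the state `v_i` is drawn
given `v_{i+1}` with probability proportional to `forward i v_i * B v_i v_{i+1}`. -/
def backwardProb {N : ℕ} (init : Fin N → ℝ≥0) (B : Matrix (Fin N) (Fin N) ℝ≥0)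
    (L : ℕ → Fin N → ℝ≥0) (k : ℕ) (v : Fin (k + 1) → Fin N) : ℝ≥0 :=
  probOf (forward init B L k) (v (Fin.last k)) *
    ∏ i : Fin k, probOf (fun s => forward init B L i s * B s (v i.succ)) (v i.castSucc)

/-! ### The Bayesian model -/

/-- A Markov jump process model on `N` states over `[0, tEnd]` with unknown parameter in `Θ`, a
Metropolis–Hastings proposal, a uniformization rate, and `m` observations with values in `𝒳`.
Densities in the parameter are taken with respect to `lam`. -/
structure Model (N m : ℕ) (Θ 𝒳 : Type*) [MeasurableSpace Θ] (lam : Measure Θ) where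
  /-- end of the time interval -/
  tEnd : ℝ
  tEnd_pos : 0 < tEnd
  /-- initial distribution `π₀` -/
  init : Fin N → ℝ≥0
  init_sum : ∑ s, init s = 1
  /-- rate matrix `A(θ)` -/
  rate : Θ → Matrix (Fin N) (Fin N) ℝ
  rate_nonneg : ∀ θ i j, i ≠ j → 0 ≤ rate θ i j
  rate_row : ∀ θ i, ∑ j, rate θ i j = 0
  rate_meas : ∀ i j, Measurable fun θ => rate θ i j
  /-- the function `Ω(θ) ≥ max_s A_s(θ)`, where `A_s(θ) = -A_{ss}(θ)` -/
  unif : Θ → ℝ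
  unif_ge : ∀ θ s, -rate θ s s ≤ unif θ
  unif_meas : Measurable unif
  /-- prior density `p(θ)` -/
  prior : Θ → ℝ≥0
  prior_meas : Measurable prior
  prior_int : ∫⁻ θ, prior θ ∂lam = 1
  /-- proposal density: `prop θ ϑ = q(ϑ | θ)` -/
  prop : Θ → Θ → ℝ≥0
  prop_meas : Measurable (Function.uncurry prop)
  prop_int : ∀ θ, ∫⁻ ϑ, prop θ ϑ ∂lam = 1
  /-- observation times -/
  obsTime : Fin m → ℝ
  obsTime_mem : ∀ j, obsTime j ∈ Set.Icc 0 tEnd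
  /-- `obsDensity j θ s x` is the density at `x` of the `j`-th observation when the state at its time
  is `s` and the parameter is `θ` -/
  obsDensity : Fin m → Θ → Fin N → 𝒳 → ℝ≥0
  obsDensity_meas : ∀ j s x, Measurable fun θ => obsDensity j θ s x

namespace Model

variable {N m : ℕ} {Θ 𝒳 : Type*} [MeasurableSpace Θ] {lam : Measure Θ}

/-- The total rate `A_s(θ)` of leaving state `s`. -/
def exitRate (M : Model N m Θ 𝒳 lam) (θ : Θ) (s : Fin N) : ℝ := -M.rate θ s s

/-- The probability `A_{ij} / A_i` of jumping from `i` to `j ≠ i`. -/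
def jumpProb (M : Model N m Θ 𝒳 lam) (θ : Θ) (i j : Fin N) : ℝ :=
  if i = j then 0 else M.rate θ i j / M.exitRate θ i

open Classical in
/-- The density `P(S(t) | θ)` with respect to `pathRef` of the Markov jump process path generated by
Gillespie's algorithm: draw `s_0` from `π₀`; in state `s_i` wait for an exponential time of rate
`A_{s_i}` and then jump to `s_{i+1}` with probability `A_{s_i s_{i+1}} / A_{s_i}`; the wait in the
last state exceeds the remaining time. Here `Fin.cons 0 t` lists `t_0 = 0, t_1, …, t_n`. -/
def pathDensity (M : Model N m Θ 𝒳 lam) (θ : Θ) (z : Path N) : ℝ≥0∞ :=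
  let t : Fin (z.1 + 1) → ℝ := Fin.cons 0 z.2.1
  let s : Fin (z.1 + 1) → Fin N := z.2.2
  if IsOrderedIn M.tEnd z.2.1 then
    ENNReal.ofReal
      ((M.init (s 0) : ℝ) *
        (∏ i : Fin z.1,
          (M.exitRate θ (s i.castSucc) *
              Real.exp (-(M.exitRate θ (s i.castSucc) * (t i.succ - t i.castSucc)))) *
            M.jumpProb θ (s i.castSucc) (s i.succ)) *
        Real.exp (-(M.exitRate θ (s (Fin.last z.1)) * (M.tEnd - t (Fin.last z.1)))))
  else 0

/-- The likelihood `P(X | S(t), θ)` of the observations given the trajectory. -/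
def pathLik (M : Model N m Θ 𝒳 lam) (X : Fin m → 𝒳) (θ : Θ) (z : Path N) : ℝ≥0 :=
  ∏ j, M.obsDensity j θ (stateAt z (M.obsTime j)) (X j)

/-- The unnormalized posterior `p(θ) P(S(t) | θ) P(X | S(t), θ)`. -/
def jointLaw (M : Model N m Θ 𝒳 lam) (X : Fin m → 𝒳) : Measure (Θ × Path N) :=
  (lam.prod (pathRef N)).withDensity fun y =>
    (M.prior y.1 : ℝ≥0∞) * M.pathDensity y.1 y.2 * (M.pathLik X y.1 y.2 : ℝ≥0∞)

/-- The marginal density `P(X)` of the observations. -/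
def evidence (M : Model N m Θ 𝒳 lam) (X : Fin m → 𝒳) : ℝ≥0∞ := M.jointLaw X Set.univ

/-- The posterior `P(θ, S(t) | X)`. -/
def posterior (M : Model N m Θ 𝒳 lam) (X : Fin m → 𝒳) : Measure (Θ × Path N) :=
  (M.evidence X)⁻¹ • M.jointLaw X

/-- The rate `Ω(θ) + Ω(ϑ)`. -/
def gridRate (M : Model N m Θ 𝒳 lam) (θ ϑ : Θ) : ℝ := M.unif θ + M.unif ϑ

/-- The transition matrix `B(θ, ϑ) = I + A(θ) / (Ω(θ) + Ω(ϑ))`, whose entries are nonnegative. -/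
def B (M : Model N m Θ 𝒳 lam) (θ ϑ : Θ) : Matrix (Fin N) (Fin N) ℝ≥0 := fun i j =>
  (((1 : Matrix (Fin N) (Fin N) ℝ) + (M.gridRate θ ϑ)⁻¹ • M.rate θ) i j).toNNReal

/-- The likelihood `L_i(s)` under state `s` of all observations in the `i`-th interval of `W`. -/
def stepLik (M : Model N m Θ 𝒳 lam) (X : Fin m → 𝒳) (θ : Θ) (W : Config) (i : ℕ) (s : Fin N) :
    ℝ≥0 :=
  ∏ j ∈ Finset.univ.filter (fun j => (intervalIndex W.2 (M.obsTime j) : ℕ) = i),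
    M.obsDensity j θ s (X j)

/-- `P(X | W, θ, ϑ)`: the likelihood of the observations when the states on the grid `W` form a
Markov chain with initial distribution `π₀` and transition matrix `B(θ, ϑ)`, which are summed
out. -/
def gridLik (M : Model N m Θ 𝒳 lam) (X : Fin m → 𝒳) (θ ϑ : Θ) (W : Config) : ℝ≥0 :=
  ∑ v : Fin (W.1 + 1) → Fin N,
    (M.init (v 0) * ∏ i : Fin W.1, M.B θ ϑ (v i.castSucc) (v i.succ)) *
      ∏ i : Fin (W.1 + 1), M.stepLik X θ W i (v i)

/-- `P(X | W, θ, ϑ)` as computed by the forward pass over `W`. -/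
def forwardLik (M : Model N m Θ 𝒳 lam) (X : Fin m → 𝒳) (θ ϑ : Θ) (W : Config) : ℝ≥0 :=
  ∑ s, forward M.init (M.B θ ϑ) (M.stepLik X θ W) W.1 s

/-! ### The symmetrized Metropolis–Hastings sampler -/

/-- The thinning intensity `R(t) = Ω(θ) + Ω(ϑ) - A_{S(t)}(θ)` on `[0, tEnd]`. -/
def thinIntensity (M : Model N m Θ 𝒳 lam) (θ ϑ : Θ) (z : Path N) : Measure ℝ :=
  (volume.restrict (Set.Icc 0 M.tEnd)).withDensity fun t =>
    ENNReal.ofReal (M.gridRate θ ϑ - M.exitRate θ (stateAt z t))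

/-- First stage: draw `ϑ` from `q(· | θ)`, draw the thinned jumps `U` from the Poisson process with
rate `R(t)`, form the grid `W = T ∪ U`, and discard the states. -/
def augment (M : Model N m Θ 𝒳 lam) (y : Θ × Path N) : Measure (Θ × Θ × Config) :=
  (lam.withDensity fun ϑ => (M.prop y.1 ϑ : ℝ≥0∞)).bind fun ϑ =>
    (poissonProcess (M.thinIntensity y.1 ϑ y.2)).map fun u =>
      (y.1, ϑ, gridOf (pts y.2.2.1 ∪ pts u.2))

/-- Swap the two parameters. -/
def swap (y : Θ × Θ × Config) : Θ × Θ × Config := (y.2.1, y.1, y.2.2)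

/-- The acceptance probability of the swap, computed from the two forward passes. A zero denominator
has probability zero in stationarity; the swap is then rejected. -/
def accept (M : Model N m Θ 𝒳 lam) (X : Fin m → 𝒳) (y : Θ × Θ × Config) : ℝ≥0 :=
  let θ := y.1
  let ϑ := y.2.1
  let W := y.2.2
  min 1 ((M.forwardLik X ϑ θ W * M.prior ϑ * M.prop ϑ θ) /
    (M.forwardLik X θ ϑ W * M.prior θ * M.prop θ ϑ))

/-- Second stage: accept or reject the proposed swap. -/
def mhStep (M : Model N m Θ 𝒳 lam) (X : Fin m → 𝒳) (y : Θ × Θ × Config) :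
    Measure (Θ × Θ × Config) :=
  (M.accept X y : ℝ≥0∞) • Measure.dirac (swap y) +
    ((1 - M.accept X y : ℝ≥0) : ℝ≥0∞) • Measure.dirac y

/-- Third stage: at `(θ', ϑ', W)`, draw states on `W` by the backward pass with `B(θ', ϑ')`, discard
the self-transitions and the auxiliary parameter, and return `(θ', S'(t))`. -/
def resample (M : Model N m Θ 𝒳 lam) (X : Fin m → 𝒳) (y : Θ × Θ × Config) :
    Measure (Θ × Path N) :=
  let W := y.2.2
  ∑ v : Fin (W.1 + 1) → Fin N,
    (backwardProb M.init (M.B y.1 y.2.1) (M.stepLik X y.1 W) W.1 v : ℝ≥0∞) •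
      Measure.dirac (y.1, thin W.2 v)

/-- One iteration of the sampler: the law of `(θ', S'(t))` given `(θ, S(t))`. -/
def step (M : Model N m Θ 𝒳 lam) (X : Fin m → 𝒳) (y : Θ × Path N) : Measure (Θ × Path N) :=
  ((M.augment y).bind (M.mhStep X)).bind (M.resample X)

/-! ### The target of the swap move -/

/-- The density `P(W | θ, ϑ)` of the Poisson grid of rate `Ω(θ) + Ω(ϑ)`. -/
def gridDensity (M : Model N m Θ 𝒳 lam) (θ ϑ : Θ) (W : Config) : ℝ≥0∞ :=
  poissonGridDensity M.tEnd (M.gridRate θ ϑ) W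

/-- `p(θ) q(ϑ | θ) P(W | θ, ϑ) P(X | W, θ, ϑ)`. -/
def extendedDensity (M : Model N m Θ 𝒳 lam) (X : Fin m → 𝒳) (y : Θ × Θ × Config) : ℝ≥0∞ :=
  (M.prior y.1 : ℝ≥0∞) * (M.prop y.1 y.2.1 : ℝ≥0∞) * M.gridDensity y.1 y.2.1 y.2.2 *
    (M.gridLik X y.1 y.2.1 y.2.2 : ℝ≥0∞)

end Model

end SymMH

end

/-! Write R = Ω(θ) + Ω(ϑ). Everything rests on one identity for fixed θ and ϑ, `lintegral_thinned`:
a trajectory of the jump process together with Poisson points of intensity R - A_{S(t)} has the same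
law as a rate-R Poisson grid carrying a Markov chain with matrix B, self-transitions deleted.
Observation weights may be included on both sides, because the likelihood sees the trajectory only
as a function of time.

The identity is a comparison of densities. The trajectory contributes π₀(s₀), one rate A_{ij} per
jump and exp(-∫ A_S). The added points contribute R - A_S each and exp(-∫ (R - A_S)). The
exponentials multiply to exp(-R tEnd), free of the trajectory (`pathDensity_mul_exp`), and every
grid point, jump or not, contributes R B (`gridRate_mul_B`). What remains is R^|W| exp(-R tEnd)
times the chain weight (`jumpRate_prod_mul_thinRate_prod`). The change of variables has two halves:
a disjoint pair of ordered grids is an ordered grid with a marked subset (`lintegral_split`), and a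
marked subset with consecutively distinct states is an arbitrary state sequence on the grid
(`sum_compress`).

The identity is used twice. With a test function of the grid, the states sum out and step 1 carries
the joint law to the extended law with density p q P(W) P(X | W) (`jointLaw_bind_augment`). With a
test function of the trajectory, the added points integrate out; since forward likelihood times
backward-pass probability is the chain weight (`sum_forward_mul_backwardProb`), step 3 carries the
extended law back to the joint law (`extendedLaw_bind_resample`).

In between, the swap preserves the extended law: P(W | θ, ϑ) depends on the parameters only through
the symmetric R, so it cancels from the Metropolis–Hastings ratio, and g α = min(g, g ∘ swap) gives
detailed balance (`extendedLaw_bind_mhStep`). All this is done with unnormalized measures; P(X)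
enters as a scalar at the end. -/

namespace SymMH

/-! ### Measurability on countable disjoint unions -/

section Sigma

variable {ι α γ : Type*} {β : ι → Type*} [MeasurableSpace α] [MeasurableSpace γ]
  [∀ i, MeasurableSpace (β i)]

theorem measurable_sigmaMk (i : ι) : Measurable (Sigma.mk i : β i → Σ i, β i) := fun s hs => by
  simp only [MeasurableSpace.measurableSet_iInf] at hs
  exact hs i

theorem measurableSet_sigma {s : Set (Σ i, β i)} :
    MeasurableSet s ↔ ∀ i, MeasurableSet (Sigma.mk i ⁻¹' s) := by
  simp only [MeasurableSpace.measurableSet_iInf]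
  rfl

theorem measurableEmbedding_sigmaMk (i : ι) :
    MeasurableEmbedding (Sigma.mk i : β i → Σ i, β i) where
  injective := sigma_mk_injective
  measurable := measurable_sigmaMk i
  measurableSet_image' s hs := by
    rw [measurableSet_sigma]
    intro j
    by_cases h : i = j
    · subst h
      rwa [Set.preimage_image_eq _ sigma_mk_injective]
    · rw [Set.preimage_image_sigmaMk_of_ne (Ne.symm h)]
      exact MeasurableSet.empty

theorem measurable_sigma {f : (Σ i, β i) → γ} (h : ∀ i, Measurable fun x : β i => f ⟨i, x⟩) :
    Measurable f := fun s hs => by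
  rw [measurableSet_sigma]
  exact fun i => h i hs

/-- The σ-algebra here is a product one, so the fibrewise criterion is no longer the definition. A
preimage is cut into countably many images of measurable sets under the embeddings `Prod.map id
(Sigma.mk i)`. -/
theorem measurable_prod_sigma [Countable ι] {f : α × (Σ i, β i) → γ}
    (h : ∀ i, Measurable fun p : α × β i => f (p.1, ⟨i, p.2⟩)) : Measurable f := fun s hs => by
  have key : f ⁻¹' s = ⋃ i, Prod.map id (Sigma.mk i) ''
      ((fun p : α × β i => f (p.1, ⟨i, p.2⟩)) ⁻¹' s) := by
    ext ⟨a, i, x⟩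
    simp only [Set.mem_preimage, Set.mem_iUnion, Set.mem_image, Prod.exists, Prod.map_apply, id]
    constructor
    · intro hx
      exact ⟨i, a, x, hx, rfl⟩
    · rintro ⟨j, b, y, hy, he⟩
      rw [← he]
      exact hy
  rw [key]
  refine MeasurableSet.iUnion fun i => ?_
  exact (MeasurableEmbedding.id.prodMap (measurableEmbedding_sigmaMk i)).measurableSet_image.2
    (h i hs)

theorem measurable_sigma_prod [Countable ι] {f : (Σ i, β i) × α → γ}
    (h : ∀ i, Measurable fun p : β i × α => f (⟨i, p.1⟩, p.2)) : Measurable f := by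
  have : Measurable fun p : α × (Σ i, β i) => f (p.2, p.1) :=
    measurable_prod_sigma fun i => (h i).comp measurable_swap
  exact this.comp measurable_swap

end Sigma

/-- A function that agrees on each set of a countable measurable cover with a measurable function
is measurable. -/
theorem measurable_of_countable_pieces {ι α β : Type*} [Countable ι] [MeasurableSpace α]
    [MeasurableSpace β] {f : α → β} (s : ι → Set α) (g : ι → α → β)
    (hs : ∀ i, MeasurableSet (s i)) (hg : ∀ i, Measurable (g i))
    (hfg : ∀ i, ∀ x ∈ s i, f x = g i x) (hcov : ∀ x, ∃ i, x ∈ s i) : Measurable f := by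
  intro t ht
  have : f ⁻¹' t = ⋃ i, s i ∩ g i ⁻¹' t := by
    ext x
    simp only [Set.mem_preimage, Set.mem_iUnion, Set.mem_inter_iff]
    constructor
    · intro hx
      obtain ⟨i, hi⟩ := hcov x
      exact ⟨i, hi, by rwa [← hfg i x hi]⟩
    · rintro ⟨i, hi, hx⟩
      rwa [hfg i x hi]
  rw [this]
  exact MeasurableSet.iUnion fun i => (hs i).inter (hg i ht)

/-- Evaluation of a function with countable domain at a random point. -/
theorem measurable_apply_of_countable {ι α β : Type*} [Countable ι] [MeasurableSpace ι]
    [MeasurableSingletonClass ι] [MeasurableSpace α] [MeasurableSpace β] {f : α → ι → β}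
    {i : α → ι} (hf : ∀ j, Measurable fun x => f x j) (hi : Measurable i) :
    Measurable fun x => f x (i x) :=
  measurable_of_countable_pieces (fun j => i ⁻¹' {j}) (fun j x => f x j)
    (fun j => hi (measurableSet_singleton j)) hf (fun j x hx => by rw [← show i x = j from hx])
    fun x => ⟨i x, rfl⟩

/-! ### Sorting, merging and evaluating point configurations -/

section Grid

theorem pts_mem {k : ℕ} {w : Fin k → ℝ} {x : ℝ} : x ∈ pts w ↔ ∃ i, w i = x := by
  simp [pts]

theorem pts_card {k : ℕ} {w : Fin k → ℝ} (h : Function.Injective w) : (pts w).card = k := by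
  rw [pts, Finset.card_image_of_injective _ h, Finset.card_univ, Fintype.card_fin]

theorem gridOf_eq_of_card {F : Finset ℝ} {k : ℕ} (h : F.card = k) :
    gridOf F = ⟨k, fun i => F.orderEmbOfFin h i⟩ := by
  subst h; rfl

theorem gridOf_pts {k : ℕ} {w : Fin k → ℝ} (h : StrictMono w) : gridOf (pts w) = ⟨k, w⟩ := by
  rw [gridOf_eq_of_card (pts_card h.injective)]
  congr 1
  exact (Finset.orderEmbOfFin_unique (pts_card h.injective)
    (fun i => pts_mem.2 ⟨i, rfl⟩) h).symm

/-- Turns the merging of two tuples into the sorting of one, so that measurability of W = T ∪ U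
reduces to `measurable_gridOf_pts`. -/
theorem pts_append {n m : ℕ} (t : Fin n → ℝ) (u : Fin m → ℝ) :
    pts (Fin.append t u) = pts t ∪ pts u := by
  ext x
  simp only [pts_mem, Finset.mem_union]
  constructor
  · rintro ⟨i, rfl⟩
    refine Fin.addCases (fun i => ?_) (fun i => ?_) i
    · exact Or.inl ⟨i, by simp⟩
    · exact Or.inr ⟨i, by simp⟩
  · rintro (⟨i, rfl⟩ | ⟨i, rfl⟩)
    · exact ⟨Fin.castAdd m i, by simp⟩
    · exact ⟨Fin.natAdd n i, by simp⟩

theorem measurableSet_strictMono {α : Type*} [MeasurableSpace α] {k : ℕ} {w : α → Fin k → ℝ}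
    (hw : Measurable w) : MeasurableSet {x | StrictMono (w x)} := by
  have : {x | StrictMono (w x)} = ⋂ (i : Fin k), ⋂ (j : Fin k), ⋂ (_ : i < j), {x | w x i < w x j} := by
    ext x
    simp [StrictMono]
  rw [this]
  refine MeasurableSet.iInter fun i => MeasurableSet.iInter fun j => MeasurableSet.iInter fun _ =>
    measurableSet_lt ((measurable_pi_apply i).comp hw) ((measurable_pi_apply j).comp hw)

/-- Sorting without repetition is, piece by piece, a selection of coordinates `w ∘ τ`. The piece of
`τ` consists of the `w` for which `w ∘ τ` is strictly increasing and attains every value of `w`;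
there are countably many `τ`, of varying length because repeated values collapse. -/
theorem measurable_gridOf_pts (k : ℕ) : Measurable fun w : Fin k → ℝ => gridOf (pts w) := by
  have hcomp : ∀ {d : ℕ} (τ : Fin d → Fin k), Measurable fun (w : Fin k → ℝ) => w ∘ τ :=
    fun τ => measurable_pi_lambda _ fun i => measurable_pi_apply (τ i)
  refine measurable_of_countable_pieces (ι := Σ d : ℕ, (Fin d → Fin k))
    (fun τ => {w | StrictMono (w ∘ τ.2) ∧ ∀ i, ∃ j, w (τ.2 j) = w i})
    (fun τ w => ⟨τ.1, w ∘ τ.2⟩) (fun τ => ?_) (fun τ => ?_) (fun τ w hw => ?_) fun w => ?_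
  · have : {w : Fin k → ℝ | ∀ i, ∃ j, w (τ.2 j) = w i} =
        ⋂ i, ⋃ j, {w : Fin k → ℝ | w (τ.2 j) = w i} := by
      ext w
      simp
    refine (measurableSet_strictMono (hcomp τ.2)).inter (s₂ := {w | ∀ i, ∃ j, w (τ.2 j) = w i}) ?_
    rw [this]
    exact MeasurableSet.iInter fun i => MeasurableSet.iUnion fun j =>
      measurableSet_eq_fun (measurable_pi_apply _) (measurable_pi_apply _)
  · exact (measurable_sigmaMk τ.1).comp (hcomp τ.2)
  · rw [← gridOf_pts hw.1]
    congr 1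
    ext x
    simp only [pts_mem]
    constructor
    · rintro ⟨i, rfl⟩
      obtain ⟨j, hj⟩ := hw.2 i
      exact ⟨j, hj⟩
    · rintro ⟨j, rfl⟩
      exact ⟨τ.2 j, rfl⟩
  · have hmem : ∀ i, ∃ j, w j = (pts w).orderEmbOfFin rfl i := fun i =>
      pts_mem.1 ((pts w).orderEmbOfFin_mem rfl i)
    choose τ hτ using hmem
    have he : w ∘ τ = (pts w).orderEmbOfFin rfl := funext hτ
    refine ⟨⟨(pts w).card, τ⟩, ?_, fun i => ?_⟩
    · show StrictMono (w ∘ τ)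
      rw [he]
      exact OrderEmbedding.strictMono _
    · have : w i ∈ Set.range ((pts w).orderEmbOfFin rfl) := by
        rw [Finset.range_orderEmbOfFin]
        exact pts_mem.2 ⟨i, rfl⟩
      obtain ⟨j, hj⟩ := this
      exact ⟨j, (hτ j).trans hj⟩

theorem measurable_append (n m : ℕ) :
    Measurable fun p : (Fin n → ℝ) × (Fin m → ℝ) => Fin.append p.1 p.2 := by
  refine measurable_pi_lambda _ fun i => Fin.addCases (fun i => ?_) (fun i => ?_) i
  · simp only [Fin.append_left]
    exact (measurable_pi_apply i).comp measurable_fst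
  · simp only [Fin.append_right]
    exact (measurable_pi_apply i).comp measurable_snd

theorem measurable_gridOf_union :
    Measurable fun p : Config × Config => gridOf (pts p.1.2 ∪ pts p.2.2) := by
  refine measurable_sigma_prod fun n => measurable_prod_sigma fun m => ?_
  simp only [← pts_append]
  exact (measurable_gridOf_pts _).comp (measurable_append n m)

theorem measurable_gridOf_pts_config : Measurable fun c : Config => gridOf (pts c.2) :=
  measurable_sigma measurable_gridOf_pts

theorem measurable_intervalIndex (k : ℕ) :
    Measurable fun p : (Fin k → ℝ) × ℝ => intervalIndex p.1 p.2 := by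
  have h : Measurable fun p : (Fin k → ℝ) × ℝ => (Finset.univ.filter fun i => p.1 i ≤ p.2).card := by
    simp only [Finset.card_filter]
    refine Finset.measurable_sum _ fun i _ => Measurable.ite ?_ measurable_const measurable_const
    exact measurableSet_le ((measurable_pi_apply i).comp measurable_fst) measurable_snd
  refine measurable_to_countable' fun i => ?_
  have : (fun p : (Fin k → ℝ) × ℝ => intervalIndex p.1 p.2) ⁻¹' {i} =
      (fun p : (Fin k → ℝ) × ℝ => (Finset.univ.filter fun i => p.1 i ≤ p.2).card) ⁻¹' {(i : ℕ)} := by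
    ext p
    simp [intervalIndex, Fin.ext_iff]
  rw [this]
  exact h (measurableSet_singleton _)

theorem measurable_stateAt (N : ℕ) : Measurable fun p : Path N × ℝ => stateAt p.1 p.2 := by
  refine measurable_sigma_prod fun n => ?_
  refine measurable_apply_of_countable (f := fun p : ((Fin n → ℝ) × (Fin (n + 1) → Fin N)) × ℝ => p.1.2)
    (i := fun p => intervalIndex p.1.1 p.2) (fun j => ?_) ?_
  · exact (measurable_pi_apply j).comp (measurable_snd.comp measurable_fst)
  · exact (measurable_intervalIndex n).comp
      ((measurable_fst.comp measurable_fst).prodMk measurable_snd)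

theorem measurable_path_times (N : ℕ) :
    Measurable fun z : Path N => (⟨z.1, z.2.1⟩ : Config) :=
  measurable_sigma fun n => (measurable_sigmaMk n).comp measurable_fst

theorem measurableSet_isOrderedIn (T : ℝ) (k : ℕ) :
    MeasurableSet {w : Fin k → ℝ | IsOrderedIn T w} := by
  have : {w : Fin k → ℝ | ∀ i, w i ∈ Set.Ioo 0 T} = ⋂ i, {w : Fin k → ℝ | w i ∈ Set.Ioo 0 T} := by
    ext w
    simp
  refine (measurableSet_strictMono measurable_id).inter (s₂ := {w | ∀ i, w i ∈ Set.Ioo 0 T}) ?_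
  rw [this]
  exact MeasurableSet.iInter fun i => measurable_pi_apply i measurableSet_Ioo

end Grid

/-! ### Integration against the reference measures -/

section Reference

instance : SFinite configRef := by
  unfold configRef
  infer_instance

instance (N : ℕ) : SFinite (pathRef N) := by
  unfold pathRef
  infer_instance

theorem lintegral_configRef {f : Config → ℝ≥0∞} (hf : Measurable f) :
    ∫⁻ c, f c ∂configRef = ∑' k : ℕ, ∫⁻ w : Fin k → ℝ, f ⟨k, w⟩ := by
  rw [configRef, lintegral_sum_measure]
  exact tsum_congr fun k => lintegral_map hf (measurable_sigmaMk k)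

/-- Puts the jump times on the same space `Config` as the thinned times and the grids, so that the
two kinds of times can be merged by `lintegral_split`. -/
theorem lintegral_pathRef {N : ℕ} {f : Path N → ℝ≥0∞} (hf : Measurable f) :
    ∫⁻ z, f z ∂pathRef N =
      ∫⁻ c, ∑ s : Fin (c.1 + 1) → Fin N, f ⟨c.1, (c.2, s)⟩ ∂configRef := by
  rw [lintegral_configRef, pathRef, lintegral_sum_measure]
  · refine tsum_congr fun n => ?_
    rw [lintegral_map hf (measurable_sigmaMk n), lintegral_prod]
    · simp only [lintegral_count, tsum_fintype]
    · exact (hf.comp (measurable_sigmaMk n)).aemeasurable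
  · refine measurable_sigma fun n => ?_
    change Measurable fun w : Fin n → ℝ => ∑ s : Fin (n + 1) → Fin N, f ⟨n, (w, s)⟩
    refine Finset.measurable_sum _ fun s _ => ?_
    exact hf.comp ((measurable_sigmaMk n).comp (measurable_id.prodMk measurable_const))

end Reference

end SymMH

namespace SymMH

/-! ### Forward filtering and backward sampling -/

section ForwardBackward

variable {N : ℕ}

/-- Thanks to the uniform fallback, the backward pass is a probability law even where a message
vanishes; the fallback has mass one because `N ≠ 0`. -/
theorem sum_probOf [NeZero N] (g : Fin N → ℝ≥0) : ∑ s, probOf g s = 1 := by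
  unfold probOf
  split_ifs with h
  · rw [Finset.sum_const, Finset.card_univ, Fintype.card_fin, nsmul_eq_mul]
    exact mul_inv_cancel₀ (Nat.cast_ne_zero.2 (NeZero.ne N))
  · rw [← Finset.sum_div]
    exact div_self h

/-- Holds without a nonvanishing assumption: if the nonnegative `g` sums to zero, then `g s = 0`,
and the fallback value is multiplied by zero. -/
theorem sum_mul_probOf (g : Fin N → ℝ≥0) (s : Fin N) : (∑ s', g s') * probOf g s = g s := by
  unfold probOf
  split_ifs with h
  · rw [h, zero_mul]
    exact ((Finset.sum_eq_zero_iff.1 h) s (Finset.mem_univ s)).symm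
  · rw [mul_comm]
    exact div_mul_cancel₀ _ h

/-- Total mass of a Markov chain that is run backwards in time. -/
theorem sum_backward_chain (k : ℕ) (Q : ℕ → Fin N → Fin N → ℝ≥0) (hQ : ∀ i s', ∑ s, Q i s' s = 1)
    (P : Fin N → ℝ≥0) (hP : ∑ s, P s = 1) :
    ∑ v : Fin (k + 1) → Fin N,
      P (v (Fin.last k)) * ∏ i : Fin k, Q i (v i.succ) (v i.castSucc) = 1 := by
  induction k generalizing Q with
  | zero =>
    simp only [Finset.univ_eq_empty, Finset.prod_empty, mul_one]
    rw [← hP]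
    exact Fintype.sum_equiv (Equiv.funUnique (Fin 1) (Fin N)) _ _ fun v => rfl
  | succ k ih =>
    -- The state `v 0` occurs only in the factor `i = 0`, which sums to one over it. The remaining
    -- factors form the same chain for the shifted `Q`.
    rw [← (Fin.consEquiv fun _ : Fin (k + 2) => Fin N).sum_comp, Fintype.sum_prod_type_right]
    rw [← ih (fun i => Q (i + 1)) fun i => hQ (i + 1)]
    refine Finset.sum_congr rfl fun v _ => ?_
    simp only [Fin.consEquiv, Equiv.coe_fn_mk, Fin.prod_univ_succ, ← Fin.succ_last, Fin.cons_succ,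
      Fin.castSucc_zero, Fin.cons_zero, ← Fin.succ_castSucc, Fin.val_zero, Fin.val_succ]
    rw [← Finset.mul_sum, ← Finset.sum_mul, hQ, one_mul]

variable (init : Fin N → ℝ≥0) (B : Matrix (Fin N) (Fin N) ℝ≥0) (L : ℕ → Fin N → ℝ≥0)

theorem sum_backwardProb [NeZero N] (k : ℕ) :
    ∑ v : Fin (k + 1) → Fin N, backwardProb init B L k v = 1 :=
  sum_backward_chain k (fun i s' => probOf fun s => forward init B L i s * B s s')
    (fun _ _ => sum_probOf _) (probOf (forward init B L k)) (sum_probOf _)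

/-- The joint weight of the hidden states `v_0, …, v_k` and the observations. -/
noncomputable def chainWeight (k : ℕ) (v : Fin (k + 1) → Fin N) : ℝ≥0 :=
  (init (v 0) * ∏ i : Fin k, B (v i.castSucc) (v i.succ)) * ∏ i : Fin (k + 1), L i (v i)

/-- A telescoping product: the message at step `k + 1` contains the normalizer of the law from which
`v_k` is drawn. Cancelling it leaves the message at step `k` times one entry of `B` and one
likelihood factor. -/
theorem forward_mul_prod_probOf (k : ℕ) (v : Fin (k + 1) → Fin N) :
    forward init B L k (v (Fin.last k)) *
        ∏ i : Fin k, probOf (fun s => forward init B L i s * B s (v i.succ)) (v i.castSucc) =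
      chainWeight init B L k v := by
  unfold chainWeight
  induction k with
  | zero => simp [forward]
  | succ k ih =>
    have ih' := ih fun i => v i.castSucc
    rw [Fin.prod_univ_castSucc, Fin.prod_univ_castSucc, Fin.prod_univ_castSucc (n := k + 1)]
    simp only [Fin.val_castSucc, Fin.val_last, Fin.succ_last, forward]
    simp only [Fin.succ_castSucc, Fin.castSucc_zero] at ih' ⊢
    have h := sum_mul_probOf (fun s => forward init B L k s * B s (v (Fin.last (k + 1))))
      (v (Fin.last k).castSucc)
    calc _ = (∏ i : Fin k, probOf (fun s => forward init B L i s * B s (v i.succ.castSucc))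
              (v i.castSucc.castSucc)) *
            ((∑ s, forward init B L k s * B s (v (Fin.last (k + 1)))) *
              probOf (fun s => forward init B L k s * B s (v (Fin.last (k + 1))))
                (v (Fin.last k).castSucc)) * L (k + 1) (v (Fin.last (k + 1))) := by ring
      _ = (forward init B L k (v (Fin.last k).castSucc) *
            ∏ i : Fin k, probOf (fun s => forward init B L i s * B s (v i.succ.castSucc))
              (v i.castSucc.castSucc)) *
            B (v (Fin.last k).castSucc) (v (Fin.last (k + 1))) *
              L (k + 1) (v (Fin.last (k + 1))) := by rw [h]; ring
      _ = _ := by rw [ih']; ring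

theorem sum_forward_mul_backwardProb (k : ℕ) (v : Fin (k + 1) → Fin N) :
    (∑ s, forward init B L k s) * backwardProb init B L k v = chainWeight init B L k v := by
  rw [backwardProb, ← mul_assoc, sum_mul_probOf, forward_mul_prod_probOf]

/-- The forward pass computes the likelihood. This comes for free from the backward pass having
total mass one. -/
theorem sum_chainWeight [NeZero N] (k : ℕ) :
    ∑ v, chainWeight init B L k v = ∑ s, forward init B L k s := by
  simp only [← sum_forward_mul_backwardProb]
  rw [← Finset.mul_sum, sum_backwardProb, mul_one]

end ForwardBackward

section ForwardBackwardMeasurability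

variable {N : ℕ} {α : Type*} [MeasurableSpace α]

theorem measurable_probOf {g : α → Fin N → ℝ≥0} (hg : ∀ s, Measurable fun x => g x s) (s : Fin N) :
    Measurable fun x => probOf (g x) s := by
  unfold probOf
  have hsum : Measurable fun x => ∑ s', g x s' := Finset.measurable_sum _ fun s _ => hg s
  exact Measurable.ite (hsum (measurableSet_singleton 0)) measurable_const ((hg s).div hsum)

variable {init : Fin N → ℝ≥0} {B : α → Matrix (Fin N) (Fin N) ℝ≥0} {L : α → ℕ → Fin N → ℝ≥0}

theorem measurable_forward (hB : ∀ i j, Measurable fun x => B x i j)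
    (hL : ∀ i s, Measurable fun x => L x i s) (k : ℕ) (s : Fin N) :
    Measurable fun x => forward init (B x) (L x) k s := by
  induction k generalizing s with
  | zero => exact measurable_const.mul (hL 0 s)
  | succ k ih =>
    exact (Finset.measurable_sum _ fun s' _ => (ih s').mul (hB s' s)).mul (hL (k + 1) s)

theorem measurable_backwardProb (hB : ∀ i j, Measurable fun x => B x i j)
    (hL : ∀ i s, Measurable fun x => L x i s) (k : ℕ) (v : Fin (k + 1) → Fin N) :
    Measurable fun x => backwardProb init (B x) (L x) k v :=
  (measurable_probOf (fun s => measurable_forward hB hL k s) _).mul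
    (Finset.measurable_prod _ fun i _ =>
      measurable_probOf (fun s => (measurable_forward hB hL i s).mul (hB s _)) _)

theorem measurable_chainWeight (hB : ∀ i j, Measurable fun x => B x i j)
    (hL : ∀ i s, Measurable fun x => L x i s) (k : ℕ) (v : Fin (k + 1) → Fin N) :
    Measurable fun x => chainWeight init (B x) (L x) k v :=
  (measurable_const.mul (Finset.measurable_prod _ fun _ _ => hB _ _)).mul
    (Finset.measurable_prod _ fun _ _ => hL _ _)

end ForwardBackwardMeasurability

/-! ### Rates, the matrix B and grid likelihoods of the model -/

namespace Model

variable {N m : ℕ} {Θ 𝒳 : Type*} [MeasurableSpace Θ] {lam : Measure Θ} (M : Model N m Θ 𝒳 lam)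
  (X : Fin m → 𝒳)

theorem neZero (M : Model N m Θ 𝒳 lam) : NeZero N := ⟨fun h => by
  subst h
  simpa using M.init_sum⟩

theorem gridLik_eq_sum (θ ϑ : Θ) (W : Config) :
    M.gridLik X θ ϑ W = ∑ v, chainWeight M.init (M.B θ ϑ) (M.stepLik X θ W) W.1 v := rfl

theorem forwardLik_eq_gridLik (θ ϑ : Θ) (W : Config) :
    M.forwardLik X θ ϑ W = M.gridLik X θ ϑ W := by
  have := M.neZero
  rw [gridLik_eq_sum, sum_chainWeight, forwardLik]

theorem gridLik_mul_backwardProb (θ ϑ : Θ) (W : Config) (v : Fin (W.1 + 1) → Fin N) :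
    M.gridLik X θ ϑ W * backwardProb M.init (M.B θ ϑ) (M.stepLik X θ W) W.1 v =
      chainWeight M.init (M.B θ ϑ) (M.stepLik X θ W) W.1 v := by
  rw [← forwardLik_eq_gridLik, forwardLik, sum_forward_mul_backwardProb]

theorem exitRate_eq_sum (θ : Θ) (s : Fin N) :
    M.exitRate θ s = ∑ j ∈ Finset.univ.erase s, M.rate θ s j := by
  have h := M.rate_row θ s
  rw [← Finset.add_sum_erase _ _ (Finset.mem_univ s)] at h
  rw [exitRate]
  linarith

theorem exitRate_nonneg (θ : Θ) (s : Fin N) : 0 ≤ M.exitRate θ s := by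
  rw [exitRate_eq_sum]
  exact Finset.sum_nonneg fun j hj => M.rate_nonneg θ s j (Finset.ne_of_mem_erase hj).symm

theorem exitRate_le_unif (θ : Θ) (s : Fin N) : M.exitRate θ s ≤ M.unif θ := M.unif_ge θ s

theorem unif_nonneg (θ : Θ) : 0 ≤ M.unif θ := by
  have := M.neZero
  exact (M.exitRate_nonneg θ 0).trans (M.exitRate_le_unif θ 0)

theorem gridRate_nonneg (θ ϑ : Θ) : 0 ≤ M.gridRate θ ϑ :=
  add_nonneg (M.unif_nonneg θ) (M.unif_nonneg ϑ)

theorem exitRate_le_gridRate (θ ϑ : Θ) (s : Fin N) : M.exitRate θ s ≤ M.gridRate θ ϑ :=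
  (M.exitRate_le_unif θ s).trans (le_add_of_nonneg_right (M.unif_nonneg ϑ))

theorem gridRate_comm (θ ϑ : Θ) : M.gridRate θ ϑ = M.gridRate ϑ θ := add_comm _ _

theorem gridDensity_comm (θ ϑ : Θ) (W : Config) : M.gridDensity θ ϑ W = M.gridDensity ϑ θ W := by
  rw [gridDensity, gridDensity, gridRate_comm]

/-- Nonnegative off-diagonal rates with sum zero all vanish. This takes care of the default values
of the divisions by zero in `jumpProb` (absorbing state) and in `B` (R = 0). -/
theorem rate_eq_zero_of_exitRate_eq_zero {θ : Θ} {s : Fin N} (h : M.exitRate θ s = 0) (j : Fin N) :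
    M.rate θ s j = 0 := by
  by_cases hj : j = s
  · subst hj
    rw [exitRate] at h
    linarith
  · rw [exitRate_eq_sum] at h
    exact (Finset.sum_eq_zero_iff_of_nonneg fun j hj =>
      M.rate_nonneg θ s j (Finset.ne_of_mem_erase hj).symm).1 h j
        (Finset.mem_erase.2 ⟨hj, Finset.mem_univ j⟩)

theorem exitRate_mul_jumpProb (θ : Θ) (i j : Fin N) :
    M.exitRate θ i * M.jumpProb θ i j = if i = j then 0 else M.rate θ i j := by
  rw [jumpProb]
  split_ifs with h
  · rw [mul_zero]
  · by_cases h0 : M.exitRate θ i = 0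
    · rw [h0, zero_mul, M.rate_eq_zero_of_exitRate_eq_zero h0]
    · exact mul_div_cancel₀ _ h0

/-- The heart of uniformization: the two cases are the intensity of a thinned time and the rate of a
jump. The truncation in `B` loses nothing when R > 0, since A_i ≤ Ω(θ) ≤ R makes the diagonal
nonnegative; when R = 0, both sides vanish. -/
theorem gridRate_mul_B (θ ϑ : Θ) (i j : Fin N) :
    M.gridRate θ ϑ * M.B θ ϑ i j =
      if i = j then M.gridRate θ ϑ - M.exitRate θ i else M.rate θ i j := by
  have hval : M.gridRate θ ϑ * ((1 : Matrix (Fin N) (Fin N) ℝ) + (M.gridRate θ ϑ)⁻¹ • M.rate θ) i j =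
      if i = j then M.gridRate θ ϑ - M.exitRate θ i else M.rate θ i j := by
    rw [Matrix.add_apply, Matrix.smul_apply, Matrix.one_apply, smul_eq_mul]
    by_cases h0 : M.gridRate θ ϑ = 0
    · have he : M.exitRate θ i = 0 :=
        le_antisymm (h0 ▸ M.exitRate_le_gridRate θ ϑ i) (M.exitRate_nonneg θ i)
      rw [h0, he, M.rate_eq_zero_of_exitRate_eq_zero he]
      simp
    · rw [mul_add, mul_inv_cancel_left₀ h0]
      split_ifs with h
      · subst h
        rw [exitRate]
        ring
      · ring
  by_cases h0 : M.gridRate θ ϑ = 0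
  · rw [← hval, h0, zero_mul, zero_mul]
  · have hpos : 0 < M.gridRate θ ϑ := lt_of_le_of_ne (M.gridRate_nonneg θ ϑ) (Ne.symm h0)
    rw [B, Real.coe_toNNReal, hval]
    refine nonneg_of_mul_nonneg_right (hval ▸ ?_) hpos
    split_ifs with h
    · exact sub_nonneg.2 (M.exitRate_le_gridRate θ ϑ i)
    · exact M.rate_nonneg θ i j h

section Measurability

theorem measurable_exitRate (s : Fin N) : Measurable fun θ => M.exitRate θ s :=
  (M.rate_meas s s).neg

theorem measurable_gridRate : Measurable fun p : Θ × Θ => M.gridRate p.1 p.2 :=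
  (M.unif_meas.comp measurable_fst).add (M.unif_meas.comp measurable_snd)

theorem measurable_B (i j : Fin N) : Measurable fun p : Θ × Θ => M.B p.1 p.2 i j := by
  refine Measurable.real_toNNReal ?_
  simp only [Matrix.add_apply, Matrix.smul_apply, smul_eq_mul]
  exact measurable_const.add
    (M.measurable_gridRate.inv.mul ((M.rate_meas i j).comp measurable_fst))

theorem measurable_stepLik (k i : ℕ) (s : Fin N) :
    Measurable fun p : Θ × (Fin k → ℝ) => M.stepLik X p.1 ⟨k, p.2⟩ i s := by
  simp only [stepLik, Finset.prod_filter]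
  refine Finset.measurable_prod _ fun j _ => Measurable.ite ?_ ?_ measurable_const
  · have h : Measurable fun p : Θ × (Fin k → ℝ) =>
        ((intervalIndex p.2 (M.obsTime j) : Fin (k + 1)) : ℕ) :=
      (measurable_of_countable fun a : Fin (k + 1) => (a : ℕ)).comp
        ((measurable_intervalIndex k).comp (measurable_snd.prodMk measurable_const))
    exact h (measurableSet_singleton i)
  · exact (M.obsDensity_meas j s (X j)).comp measurable_fst

theorem measurable_chainWeight_model (k : ℕ) (v : Fin (k + 1) → Fin N) :
    Measurable fun p : Θ × Θ × (Fin k → ℝ) =>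
      chainWeight M.init (M.B p.1 p.2.1) (M.stepLik X p.1 ⟨k, p.2.2⟩) k v :=
  measurable_chainWeight
    (fun i j => (M.measurable_B i j).comp (measurable_fst.prodMk (measurable_fst.comp measurable_snd)))
    (fun i s => (M.measurable_stepLik X k i s).comp
      (measurable_fst.prodMk (measurable_snd.comp measurable_snd))) k v

theorem measurable_backwardProb_model (k : ℕ) (v : Fin (k + 1) → Fin N) :
    Measurable fun p : Θ × Θ × (Fin k → ℝ) =>
      backwardProb M.init (M.B p.1 p.2.1) (M.stepLik X p.1 ⟨k, p.2.2⟩) k v :=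
  measurable_backwardProb
    (fun i j => (M.measurable_B i j).comp (measurable_fst.prodMk (measurable_fst.comp measurable_snd)))
    (fun i s => (M.measurable_stepLik X k i s).comp
      (measurable_fst.prodMk (measurable_snd.comp measurable_snd))) k v

theorem measurable_prod_config {γ : Type*} [MeasurableSpace γ] {f : Θ × Θ × Config → γ}
    (h : ∀ k, Measurable fun p : Θ × Θ × (Fin k → ℝ) => f (p.1, p.2.1, ⟨k, p.2.2⟩)) :
    Measurable f := by
  have : Measurable fun p : (Θ × Θ) × Config => f (p.1.1, p.1.2, p.2) :=
    measurable_prod_sigma fun k => (h k).comp MeasurableEquiv.prodAssoc.measurable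
  exact this.comp MeasurableEquiv.prodAssoc.symm.measurable

theorem measurable_gridLik : Measurable fun y : Θ × Θ × Config => M.gridLik X y.1 y.2.1 y.2.2 := by
  refine measurable_prod_config fun k => ?_
  change Measurable fun p : Θ × Θ × (Fin k → ℝ) => ∑ v : Fin (k + 1) → Fin N,
    chainWeight M.init (M.B p.1 p.2.1) (M.stepLik X p.1 ⟨k, p.2.2⟩) k v
  exact Finset.measurable_sum _ fun v _ => M.measurable_chainWeight_model X k v

end Measurability

end Model

end SymMH

namespace SymMH

/-! ### Lebesgue measure on tuples and ordered tuples -/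

section Lebesgue

theorem measurePreserving_comp_equiv {ι ι' : Type*} [Fintype ι] [Fintype ι'] (e : ι' ≃ ι) :
    MeasurePreserving (fun x : ι → ℝ => x ∘ e) volume volume := by
  have h := volume_measurePreserving_piCongrLeft (fun _ : ι' => ℝ) e.symm
  convert h using 1
  ext x i
  obtain ⟨j, rfl⟩ := e.symm.surjective i
  rw [MeasurableEquiv.coe_piCongrLeft, Equiv.piCongrLeft_apply_apply]
  simp

theorem lintegral_fin_prod (m : ℕ) {f : Fin m → ℝ → ℝ≥0∞} (hf : ∀ i, Measurable (f i)) :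
    ∫⁻ x : Fin m → ℝ, ∏ i, f i (x i) = ∏ i, ∫⁻ t, f i t := by
  induction m with
  | zero => simp [lintegral_unique, volume_pi]
  | succ m ih =>
    have hm : Measurable fun x : Fin (m + 1) → ℝ => ∏ i, f i (x i) :=
      Finset.measurable_prod _ fun i _ => (hf i).comp (measurable_pi_apply i)
    rw [← (volume_preserving_piFinSuccAbove (fun _ : Fin (m + 1) => ℝ) 0).symm.lintegral_comp hm]
    simp only [Fin.prod_univ_succ, MeasurableEquiv.piFinSuccAbove_symm_apply, Fin.insertNthEquiv_zero]
    simp only [Fin.consEquiv, Equiv.coe_fn_mk, Fin.cons_zero, Fin.cons_succ]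
    rw [← ih fun i : Fin m => hf i.succ]
    exact lintegral_prod_mul (hf 0).aemeasurable
      (Finset.measurable_prod _ fun (i : Fin m) _ => (hf i.succ).comp (measurable_pi_apply i)).aemeasurable

/-- Checked on boxes, where the indicator is a product over the coordinates and Tonelli factorizes
the integral. -/
theorem pi_withDensity (m : ℕ) {ρ : ℝ → ℝ≥0∞} (hρ : Measurable ρ)
    [SigmaFinite (volume.withDensity ρ)] :
    Measure.pi (fun _ : Fin m => volume.withDensity ρ) =
      (volume : Measure (Fin m → ℝ)).withDensity fun x => ∏ i, ρ (x i) := by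
  refine Measure.pi_eq fun s hs => ?_
  rw [withDensity_apply _ (MeasurableSet.univ_pi hs), ← lintegral_indicator (MeasurableSet.univ_pi hs)]
  have h : ∀ x : Fin m → ℝ, (Set.univ.pi s).indicator (fun x => ∏ i, ρ (x i)) x =
      ∏ i, (s i).indicator ρ (x i) := by
    intro x
    by_cases hx : x ∈ Set.univ.pi s
    · rw [Set.indicator_of_mem hx]
      exact Finset.prod_congr rfl fun i _ => (Set.indicator_of_mem (hx i trivial) _).symm
    · rw [Set.indicator_of_notMem hx]
      obtain ⟨i, hi⟩ : ∃ i, x i ∉ s i := by simpa [Set.mem_pi] using hx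
      exact (Finset.prod_eq_zero (Finset.mem_univ i) (Set.indicator_of_notMem hi _)).symm
  rw [lintegral_congr h, lintegral_fin_prod m fun i => hρ.indicator (hs i)]
  exact Finset.prod_congr rfl fun i _ => by
    rw [lintegral_indicator (hs i), withDensity_apply _ (hs i)]

theorem ae_coord_ne {k : ℕ} (i : Fin k) (c : ℝ) : ∀ᵐ x : Fin k → ℝ, x i ≠ c :=
  Measure.ae_eval_ne (fun _ : Fin k => (volume : Measure ℝ)) i c

/-- Each diagonal x_i = x_j is a proper linear subspace (it misses the i-th basis vector), hence a
null set. -/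
theorem ae_injective (k : ℕ) : ∀ᵐ x : Fin k → ℝ, Function.Injective x := by
  have h : ∀ i j : Fin k, i ≠ j → ∀ᵐ x : Fin k → ℝ, x i ≠ x j := by
    intro i j hij
    let E : Submodule ℝ (Fin k → ℝ) :=
      LinearMap.ker (LinearMap.proj (R := ℝ) (φ := fun _ : Fin k => ℝ) i - LinearMap.proj j)
    have hE : E ≠ ⊤ := by
      intro hE
      have : Pi.single i (1 : ℝ) ∈ E := hE ▸ Submodule.mem_top
      simp [E, hij.symm] at this
    have := Measure.addHaar_submodule volume E hE
    rw [← compl_mem_ae_iff] at this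
    filter_upwards [this] with x hx he
    exact hx (by simp [E, he])
  have h' : ∀ᵐ x : Fin k → ℝ, ∀ i j : Fin k, i ≠ j → x i ≠ x j :=
    ae_all_iff.2 fun i => ae_all_iff.2 fun j => by
      by_cases hij : i = j
      · simp [hij]
      · filter_upwards [h i j hij] with x hx _ using hx
  filter_upwards [h'] with x hx i j hij
  by_contra hne
  exact hx i j hne hij

/-- The ordered grids in `(0, T)`. -/
def orderedConfig (T : ℝ) : Set Config := {c | IsOrderedIn T c.2}

theorem measurableSet_orderedConfig (T : ℝ) : MeasurableSet (orderedConfig T) :=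
  measurableSet_sigma.2 fun k => measurableSet_isOrderedIn T k

theorem existsUnique_sort {T : ℝ} {m : ℕ} {x : Fin m → ℝ} (hx : Function.Injective x)
    (hT : ∀ i, x i ∈ Set.Ioo 0 T) : ∃! σ : Equiv.Perm (Fin m), IsOrderedIn T (x ∘ σ) := by
  refine ⟨Tuple.sort x, ⟨?_, fun i => hT _⟩, fun σ hσ => ?_⟩
  · exact (Tuple.monotone_sort x).strictMono_of_injective (hx.comp (Tuple.sort x).injective)
  · have h := Tuple.unique_monotone hσ.1.monotone (Tuple.monotone_sort x)
    exact Equiv.ext fun i => hx (congrFun h i)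

/-- A symmetric function integrates over the cube to `m!` times its integral over ordered tuples. -/
theorem lintegral_eq_factorial_mul_lintegral_ordered {T : ℝ} {m : ℕ} {f : (Fin m → ℝ) → ℝ≥0∞}
    (hf : Measurable f) (hsymm : ∀ (σ : Equiv.Perm (Fin m)) x, f (x ∘ σ) = f x)
    (h0 : ∀ x i, x i ∉ Set.Icc 0 T → f x = 0) :
    ∫⁻ x, f x = m.factorial * ∫⁻ x, {x | IsOrderedIn T x}.indicator f x := by
  have hO := measurableSet_isOrderedIn T m
  -- Almost every tuple in the cube is put in order by exactly one permutation, so exactly one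
  -- summand is nonzero. Coordinates equal to 0 or `T` are discarded because ordered tuples lie in
  -- the open interval, while `f` may live on the closed one.
  have hae : ∀ᵐ x : Fin m → ℝ,
      f x = ∑ σ : Equiv.Perm (Fin m), {x | IsOrderedIn T x}.indicator f (x ∘ σ) := by
    filter_upwards [ae_injective m, ae_all_iff.2 fun i => ae_coord_ne i 0,
      ae_all_iff.2 fun i => ae_coord_ne i T] with x hx hx0 hxT
    by_cases hI : ∀ i, x i ∈ Set.Icc 0 T
    · have hT : ∀ i, x i ∈ Set.Ioo 0 T := fun i =>
        ⟨lt_of_le_of_ne (hI i).1 (hx0 i).symm, lt_of_le_of_ne (hI i).2 (hxT i)⟩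
      obtain ⟨σ, hσ, huniq⟩ := existsUnique_sort hx hT
      rw [Finset.sum_eq_single σ]
      · rw [Set.indicator_of_mem (show x ∘ σ ∈ {x | IsOrderedIn T x} from hσ), hsymm]
      · intro τ _ hτ
        exact Set.indicator_of_notMem (s := {x | IsOrderedIn T x}) (fun h => hτ (huniq τ h)) _
      · exact fun h => absurd (Finset.mem_univ σ) h
    · obtain ⟨i, hi⟩ := not_forall.1 hI
      rw [h0 x i hi]
      exact (Finset.sum_eq_zero fun σ _ => (Set.indicator_apply_eq_zero (s := {x | IsOrderedIn T x})).2
        fun _ => (hsymm σ x).trans (h0 x i hi)).symm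
  rw [lintegral_congr_ae hae, lintegral_finsetSum]
  · have : ∀ σ : Equiv.Perm (Fin m), ∫⁻ x : Fin m → ℝ, {x | IsOrderedIn T x}.indicator f (x ∘ σ) =
        ∫⁻ x, {x | IsOrderedIn T x}.indicator f x := fun σ =>
      (measurePreserving_comp_equiv σ).lintegral_comp (hf.indicator hO)
    rw [Finset.sum_congr rfl fun σ _ => this σ, Finset.sum_const, Finset.card_univ,
      Fintype.card_perm, Fintype.card_fin, nsmul_eq_mul]
  · exact fun σ _ => (hf.indicator hO).comp (measurePreserving_comp_equiv σ).measurable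

end Lebesgue

/-! ### Merging two ordered grids into one -/

section Split

/-- The sub-tuple of a grid with the indices in `I`. -/
def subConfig (W : Config) (I : Finset (Fin W.1)) : Config :=
  ⟨I.card, fun a => W.2 (I.orderEmbOfFin rfl a)⟩

theorem subConfig_eq_of_card {k n : ℕ} (w : Fin k → ℝ) (I : Finset (Fin k)) (h : I.card = n) :
    subConfig ⟨k, w⟩ I = ⟨n, fun a => w (I.orderEmbOfFin h a)⟩ := by
  subst h; rfl

theorem measurable_subConfig {k : ℕ} (I : Finset (Fin k)) :
    Measurable fun w : Fin k → ℝ => subConfig ⟨k, w⟩ I :=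
  (measurable_sigmaMk I.card).comp
    (measurable_pi_lambda (fun (w : Fin k → ℝ) a => w (I.orderEmbOfFin rfl a)) fun _ => measurable_pi_apply _)

theorem pts_subConfig (W : Config) (I : Finset (Fin W.1)) :
    pts (subConfig W I).2 = I.image W.2 := by
  ext x
  simp only [pts_mem, Finset.mem_image]
  constructor
  · rintro ⟨a, rfl⟩
    exact ⟨_, I.orderEmbOfFin_mem rfl a, rfl⟩
  · rintro ⟨i, hi, rfl⟩
    have : i ∈ Set.range (I.orderEmbOfFin rfl) := by rwa [Finset.range_orderEmbOfFin]
    obtain ⟨a, ha⟩ := this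
    exact ⟨a, by simp [subConfig, ha]⟩

theorem IsOrderedIn.subConfig {T : ℝ} {W : Config} (h : IsOrderedIn T W.2) (I : Finset (Fin W.1)) :
    IsOrderedIn T (subConfig W I).2 :=
  ⟨h.1.comp (OrderEmbedding.strictMono _), fun _ => h.2 _⟩

/-- Interleaving two tuples along an index set. -/
noncomputable def interleave {n m k : ℕ} (e : Fin n ⊕ Fin m ≃ Fin k) (t : Fin n → ℝ)
    (u : Fin m → ℝ) : Fin k → ℝ := Sum.elim t u ∘ e.symm

/-- The index set must consist of the positions occupied by `t` in the sorted union `w`. The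
cardinalities are quantified inside because `finSumEquivOfFinset` takes them as arguments. -/
theorem existsUnique_interleave {T : ℝ} {n m : ℕ} {t : Fin n → ℝ} {u : Fin m → ℝ}
    (ht : IsOrderedIn T t) (hu : IsOrderedIn T u) (hd : ∀ i j, t i ≠ u j) :
    ∃ I : Finset (Fin (n + m)), (∃ (hn : I.card = n) (hm : Iᶜ.card = m),
        IsOrderedIn T (interleave (finSumEquivOfFinset hn hm) t u)) ∧
      ∀ J : Finset (Fin (n + m)), ∀ (hn : J.card = n) (hm : Jᶜ.card = m),
        IsOrderedIn T (interleave (finSumEquivOfFinset hn hm) t u) → J = I := by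
  have hcard : (pts t ∪ pts u).card = n + m := by
    rw [Finset.card_union_of_disjoint, pts_card ht.1.injective, pts_card hu.1.injective]
    rw [Finset.disjoint_left]
    intro x hx hx'
    obtain ⟨i, rfl⟩ := pts_mem.1 hx
    obtain ⟨j, hj⟩ := pts_mem.1 hx'
    exact hd i j hj.symm
  set w : Fin (n + m) → ℝ := fun i => (pts t ∪ pts u).orderEmbOfFin hcard i with hw
  have hwm : StrictMono w := OrderEmbedding.strictMono _
  have hrange : ∀ x, x ∈ pts t ∪ pts u ↔ ∃ i, w i = x := by
    intro x
    rw [← Finset.mem_coe, ← Finset.range_orderEmbOfFin _ hcard]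
    rfl
  set I : Finset (Fin (n + m)) := Finset.univ.filter fun i => w i ∈ pts t with hI
  have himage : I.image w = pts t := by
    ext x
    simp only [hI, Finset.mem_image, Finset.mem_filter, Finset.mem_univ, true_and]
    constructor
    · rintro ⟨i, hi, rfl⟩
      exact hi
    · intro hx
      obtain ⟨i, rfl⟩ := (hrange x).1 (Finset.mem_union_left _ hx)
      exact ⟨i, hx, rfl⟩
  have himage' : Iᶜ.image w = pts u := by
    ext x
    simp only [hI, Finset.mem_image, Finset.mem_compl, Finset.mem_filter, Finset.mem_univ, true_and]
    constructor
    · rintro ⟨i, hi, rfl⟩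
      exact (Finset.mem_union.1 ((hrange _).2 ⟨i, rfl⟩)).resolve_left hi
    · intro hx
      obtain ⟨i, rfl⟩ := (hrange x).1 (Finset.mem_union_right _ hx)
      refine ⟨i, fun hi => ?_, rfl⟩
      obtain ⟨a, ha⟩ := pts_mem.1 hi
      obtain ⟨b, hb⟩ := pts_mem.1 hx
      exact hd a b (ha.trans hb.symm)
  have hn : I.card = n := by
    rw [← Finset.card_image_of_injective I hwm.injective, himage, pts_card ht.1.injective]
  have hm : Iᶜ.card = m := by
    rw [← Finset.card_image_of_injective Iᶜ hwm.injective, himage', pts_card hu.1.injective]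
  refine ⟨I, ⟨hn, hm, ?_⟩, ?_⟩
  · have ht' : t = fun a => w (I.orderEmbOfFin hn a) := by
      have h1 := Finset.orderEmbOfFin_unique (pts_card ht.1.injective) (f := t)
        (fun i => pts_mem.2 ⟨i, rfl⟩) ht.1
      have h2 := Finset.orderEmbOfFin_unique (pts_card ht.1.injective)
        (f := fun a => w (I.orderEmbOfFin hn a))
        (fun a => (Finset.mem_filter.1 (I.orderEmbOfFin_mem hn a)).2)
        (hwm.comp (OrderEmbedding.strictMono _))
      rw [h1, h2]
    have hu' : u = fun a => w (Iᶜ.orderEmbOfFin hm a) := by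
      have h1 := Finset.orderEmbOfFin_unique (pts_card hu.1.injective) (f := u)
        (fun i => pts_mem.2 ⟨i, rfl⟩) hu.1
      have h2 := Finset.orderEmbOfFin_unique (pts_card hu.1.injective)
        (f := fun a => w (Iᶜ.orderEmbOfFin hm a))
        (fun a => himage' ▸ Finset.mem_image_of_mem w (Iᶜ.orderEmbOfFin_mem hm a))
        (hwm.comp (OrderEmbedding.strictMono _))
      rw [h1, h2]
    have he : interleave (finSumEquivOfFinset hn hm) t u = w := by
      funext i
      obtain ⟨j, rfl⟩ := (finSumEquivOfFinset hn hm).surjective i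
      rw [interleave, Function.comp_apply, Equiv.symm_apply_apply]
      rcases j with a | a
      · rw [finSumEquivOfFinset_inl, Sum.elim_inl, ht']
      · rw [finSumEquivOfFinset_inr, Sum.elim_inr, hu']
    rw [he]
    refine ⟨hwm, fun i => ?_⟩
    rcases Finset.mem_union.1 ((hrange _).2 ⟨i, rfl⟩) with h | h
    · obtain ⟨a, ha⟩ := pts_mem.1 h
      exact ha ▸ ht.2 a
    · obtain ⟨a, ha⟩ := pts_mem.1 h
      exact ha ▸ hu.2 a
  · intro J hJ hJ' hord
    set w' := interleave (finSumEquivOfFinset hJ hJ') t u with hw'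
    have hl : ∀ a, w' (finSumEquivOfFinset hJ hJ' (Sum.inl a)) = t a := fun a => by
      rw [hw', interleave, Function.comp_apply, Equiv.symm_apply_apply, Sum.elim_inl]
    have hr : ∀ a, w' (finSumEquivOfFinset hJ hJ' (Sum.inr a)) = u a := fun a => by
      rw [hw', interleave, Function.comp_apply, Equiv.symm_apply_apply, Sum.elim_inr]
    -- Any increasing interleaving enumerates the same set of `n + m` points, and an increasing
    -- enumeration is unique. Hence `J` is read off from `w`.
    have hww : w' = w := by
      refine Finset.orderEmbOfFin_unique hcard (fun i => ?_) hord.1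
      obtain ⟨j, rfl⟩ := (finSumEquivOfFinset hJ hJ').surjective i
      rcases j with a | a
      · rw [hl]
        exact Finset.mem_union_left _ (pts_mem.2 ⟨a, rfl⟩)
      · rw [hr]
        exact Finset.mem_union_right _ (pts_mem.2 ⟨a, rfl⟩)
    ext i
    rw [hI, Finset.mem_filter, ← hww]
    obtain ⟨j, rfl⟩ := (finSumEquivOfFinset hJ hJ').surjective i
    rcases j with a | a
    · rw [hl, finSumEquivOfFinset_inl]
      exact ⟨fun _ => ⟨Finset.mem_univ _, pts_mem.2 ⟨a, rfl⟩⟩, fun _ => J.orderEmbOfFin_mem hJ a⟩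
    · rw [hr, finSumEquivOfFinset_inr]
      refine ⟨fun h => absurd h (Finset.mem_compl.1 (Jᶜ.orderEmbOfFin_mem hJ' a)), fun h => ?_⟩
      obtain ⟨b, hb⟩ := pts_mem.1 h.2
      exact absurd hb (hd b a)

theorem IsOrderedIn.of_interleave {T : ℝ} {n m k : ℕ} {t : Fin n → ℝ} {u : Fin m → ℝ}
    {I : Finset (Fin k)} (hn : I.card = n) (hm : Iᶜ.card = m)
    (h : IsOrderedIn T (interleave (finSumEquivOfFinset hn hm) t u)) :
    IsOrderedIn T t ∧ IsOrderedIn T u := by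
  have hl : ∀ a, interleave (finSumEquivOfFinset hn hm) t u (I.orderEmbOfFin hn a) = t a := fun a => by
    rw [← finSumEquivOfFinset_inl hn hm, interleave, Function.comp_apply, Equiv.symm_apply_apply,
      Sum.elim_inl]
  have hr : ∀ a, interleave (finSumEquivOfFinset hn hm) t u (Iᶜ.orderEmbOfFin hm a) = u a := fun a => by
    rw [← finSumEquivOfFinset_inr hn hm, interleave, Function.comp_apply, Equiv.symm_apply_apply,
      Sum.elim_inr]
  refine ⟨⟨fun a b hab => ?_, fun a => hl a ▸ h.2 _⟩, ⟨fun a b hab => ?_, fun a => hr a ▸ h.2 _⟩⟩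
  · rw [← hl a, ← hl b]
    exact h.1 ((I.orderEmbOfFin hn).strictMono hab)
  · rw [← hr a, ← hr b]
    exact h.1 ((Iᶜ.orderEmbOfFin hm).strictMono hab)

theorem measurable_interleave {n m k : ℕ} (e : Fin n ⊕ Fin m ≃ Fin k) :
    Measurable fun p : (Fin n → ℝ) × (Fin m → ℝ) => interleave e p.1 p.2 := by
  refine measurable_pi_lambda _ fun i => ?_
  obtain ⟨j, rfl⟩ := e.surjective i
  simp only [interleave, Function.comp_apply, Equiv.symm_apply_apply]
  rcases j with a | a
  · exact (measurable_pi_apply a).comp measurable_fst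
  · exact (measurable_pi_apply a).comp measurable_snd

/-- For a fixed `I`, splitting `w` into its entries in `I` and in `Iᶜ` is a permutation of
coordinates followed by the identification of ℝ^(n+m) with ℝ^n × ℝ^m, so it preserves Lebesgue
measure. -/
theorem lintegral_subConfig {T : ℝ} {n m : ℕ} {H : Config × Config → ℝ≥0∞} (hH : Measurable H)
    (I : Finset (Fin (n + m))) (hn : I.card = n) (hm : Iᶜ.card = m) :
    ∫⁻ w : Fin (n + m) → ℝ, {w | IsOrderedIn T w}.indicator
        (fun w => H (subConfig ⟨n + m, w⟩ I, subConfig ⟨n + m, w⟩ Iᶜ)) w =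
      ∫⁻ t : Fin n → ℝ, ∫⁻ u : Fin m → ℝ,
        {p : (Fin n → ℝ) × (Fin m → ℝ) |
          IsOrderedIn T (interleave (finSumEquivOfFinset hn hm) p.1 p.2)}.indicator
          (fun p => H (⟨n, p.1⟩, ⟨m, p.2⟩)) (t, u) := by
  set e := finSumEquivOfFinset hn hm
  have hmeas : Measurable ({p : (Fin n → ℝ) × (Fin m → ℝ) |
      IsOrderedIn T (interleave e p.1 p.2)}.indicator (fun p => H (⟨n, p.1⟩, ⟨m, p.2⟩))) :=
    (hH.comp (((measurable_sigmaMk n).comp measurable_fst).prodMk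
      ((measurable_sigmaMk m).comp measurable_snd))).indicator
      (measurable_interleave e (measurableSet_isOrderedIn T (n + m)))
  have hmp := (volume_measurePreserving_sumPiEquivProdPi (fun _ : Fin n ⊕ Fin m => ℝ)).comp
    (measurePreserving_comp_equiv e)
  rw [← lintegral_prod _ hmeas.aemeasurable, ← Measure.volume_eq_prod, ← hmp.lintegral_comp hmeas]
  refine lintegral_congr fun w => ?_
  have hw : interleave e (fun a => w (e (Sum.inl a))) (fun a => w (e (Sum.inr a))) = w := by
    funext i
    obtain ⟨j, rfl⟩ := e.surjective i
    rcases j with a | a <;> simp [interleave]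
  have h1 : subConfig ⟨n + m, w⟩ I = ⟨n, fun a => w (e (Sum.inl a))⟩ := subConfig_eq_of_card w I hn
  have h2 : subConfig ⟨n + m, w⟩ Iᶜ = ⟨m, fun a => w (e (Sum.inr a))⟩ := subConfig_eq_of_card w Iᶜ hm
  have h3 : (MeasurableEquiv.sumPiEquivProdPi (fun _ : Fin n ⊕ Fin m => ℝ)) (w ∘ e) =
      (fun a => w (e (Sum.inl a)), fun a => w (e (Sum.inr a))) := rfl
  rw [Function.comp_apply, h3]
  by_cases ho : IsOrderedIn T w
  · rw [Set.indicator_of_mem (show w ∈ {w | IsOrderedIn T w} from ho), Set.indicator_of_mem, h1, h2]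
    change IsOrderedIn T (interleave e _ _)
    rwa [hw]
  · rw [Set.indicator_of_notMem (show w ∉ {w | IsOrderedIn T w} from ho), Set.indicator_of_notMem]
    change ¬ IsOrderedIn T (interleave e _ _)
    rwa [hw]

/-- For almost every `u`, the tuples `t` and `u` share no point. Then, if both are ordered, exactly
one `I` of size `n` interleaves them into an ordered tuple; otherwise none does. The indicator of
ordered pairs is thus a sum of indicators over `I`. -/
theorem lintegral_split_fin {T : ℝ} {H : Config × Config → ℝ≥0∞} (hH : Measurable H) (n m : ℕ) :
    ∫⁻ t : Fin n → ℝ, ∫⁻ u : Fin m → ℝ, {t | IsOrderedIn T t}.indicator 1 t *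
        ({u | IsOrderedIn T u}.indicator 1 u * H (⟨n, t⟩, ⟨m, u⟩)) =
      ∑ I : Finset (Fin (n + m)), if I.card = n then
        ∫⁻ w : Fin (n + m) → ℝ, {w | IsOrderedIn T w}.indicator
          (fun w => H (subConfig ⟨n + m, w⟩ I, subConfig ⟨n + m, w⟩ Iᶜ)) w else 0 := by
  have hc : ∀ I : Finset (Fin (n + m)), I.card = n → Iᶜ.card = m := fun I hn => by
    rw [Finset.card_compl, hn, Fintype.card_fin, Nat.add_sub_cancel_left]
  have hmeas : ∀ (I : Finset (Fin (n + m))) (hn : I.card = n) (hm : Iᶜ.card = m),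
      Measurable ({p : (Fin n → ℝ) × (Fin m → ℝ) |
      IsOrderedIn T (interleave (finSumEquivOfFinset hn hm) p.1 p.2)}.indicator
        (fun p => H (⟨n, p.1⟩, ⟨m, p.2⟩))) := fun I hn hm =>
    (hH.comp (((measurable_sigmaMk n).comp measurable_fst).prodMk
      ((measurable_sigmaMk m).comp measurable_snd))).indicator
      (measurable_interleave _ (measurableSet_isOrderedIn T (n + m)))
  let F : Finset (Fin (n + m)) → (Fin n → ℝ) × (Fin m → ℝ) → ℝ≥0∞ := fun I p =>
    if hn : I.card = n then {p : (Fin n → ℝ) × (Fin m → ℝ) |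
      IsOrderedIn T (interleave (finSumEquivOfFinset hn (hc I hn)) p.1 p.2)}.indicator
        (fun p => H (⟨n, p.1⟩, ⟨m, p.2⟩)) p else 0
  have hF : ∀ I, Measurable (F I) := fun I => by
    by_cases hn : I.card = n
    · simp only [F, hn, dite_true]
      exact hmeas I hn (hc I hn)
    · simp only [F, hn, dite_false]
      exact measurable_const
  have hR : ∀ I : Finset (Fin (n + m)), (if I.card = n then
        ∫⁻ w : Fin (n + m) → ℝ, {w | IsOrderedIn T w}.indicator
          (fun w => H (subConfig ⟨n + m, w⟩ I, subConfig ⟨n + m, w⟩ Iᶜ)) w else 0) =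
      ∫⁻ t : Fin n → ℝ, ∫⁻ u : Fin m → ℝ, F I (t, u) := fun I => by
    by_cases hn : I.card = n
    · rw [if_pos hn, lintegral_subConfig hH I hn (hc I hn)]
      simp only [F, hn, dite_true]
    · simp only [F, hn, if_false, dite_false, lintegral_zero]
  rw [Finset.sum_congr rfl fun I _ => hR I, ← lintegral_finsetSum _ fun I _ => (hF I).lintegral_prod_right']
  refine lintegral_congr fun t => ?_
  rw [← lintegral_finsetSum (f := fun I u => F I (t, u)) _
    fun I _ => (hF I).comp measurable_prodMk_left]
  have hd : ∀ᵐ u : Fin m → ℝ, ∀ i j, t i ≠ u j :=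
    ae_all_iff.2 fun i => ae_all_iff.2 fun j => (ae_coord_ne j (t i)).mono fun u hu => hu.symm
  refine lintegral_congr_ae (hd.mono fun u hu => ?_)
  dsimp only
  by_cases ho : IsOrderedIn T t ∧ IsOrderedIn T u
  · obtain ⟨I, ⟨hn, hm, hI⟩, huniq⟩ := existsUnique_interleave ho.1 ho.2 hu
    rw [Set.indicator_of_mem (show t ∈ {t | IsOrderedIn T t} from ho.1),
      Set.indicator_of_mem (show u ∈ {u | IsOrderedIn T u} from ho.2), Pi.one_apply, Pi.one_apply,
      one_mul, one_mul, Finset.sum_eq_single I]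
    · simp only [F, hn, dite_true]
      rw [Set.indicator_of_mem]
      exact hI
    · intro J _ hJ
      by_cases hn' : J.card = n
      · simp only [F, hn', dite_true]
        exact Set.indicator_of_notMem (s := {p : (Fin n → ℝ) × (Fin m → ℝ) |
          IsOrderedIn T (interleave (finSumEquivOfFinset hn' (hc J hn')) p.1 p.2)})
          (fun h => hJ (huniq J hn' (hc J hn') h)) _
      · simp only [F, hn', dite_false]
    · exact fun h => absurd (Finset.mem_univ I) h
  · have hz : ∀ I, F I (t, u) = 0 := fun I => by
      by_cases hn : I.card = n
      · simp only [F, hn, dite_true]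
        exact Set.indicator_of_notMem (s := {p : (Fin n → ℝ) × (Fin m → ℝ) |
          IsOrderedIn T (interleave (finSumEquivOfFinset hn (hc I hn)) p.1 p.2)})
          (fun h => ho (IsOrderedIn.of_interleave hn (hc I hn) h)) _
      · simp only [F, hn, dite_false]
    rw [Finset.sum_eq_zero fun I _ => hz I]
    by_cases ht : IsOrderedIn T t
    · rw [Set.indicator_of_notMem (show u ∉ {u | IsOrderedIn T u} from fun hu => ho ⟨ht, hu⟩),
        zero_mul, mul_zero]
    · rw [Set.indicator_of_notMem (show t ∉ {t | IsOrderedIn T t} from ht), zero_mul]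

theorem measurable_sum_subConfig {H : Config × Config → ℝ≥0∞} (hH : Measurable H) :
    Measurable fun W : Config => ∑ I : Finset (Fin W.1), H (subConfig W I, subConfig W Iᶜ) := by
  refine measurable_sigma fun k => ?_
  change Measurable fun w : Fin k → ℝ =>
    ∑ I : Finset (Fin k), H (subConfig ⟨k, w⟩ I, subConfig ⟨k, w⟩ Iᶜ)
  exact Finset.measurable_sum _ fun I _ =>
    hH.comp ((measurable_subConfig I).prodMk (measurable_subConfig Iᶜ))

theorem setLIntegral_orderedConfig {T : ℝ} {f : Config → ℝ≥0∞} (hf : Measurable f) :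
    ∫⁻ c in orderedConfig T, f c ∂configRef =
      ∑' k : ℕ, ∫⁻ w : Fin k → ℝ, {w | IsOrderedIn T w}.indicator (fun w => f ⟨k, w⟩) w := by
  rw [← lintegral_indicator (measurableSet_orderedConfig T),
    lintegral_configRef (hf.indicator (measurableSet_orderedConfig T))]
  rfl

/-- Two ordered grids are the same as one ordered grid with a distinguished subset of its points. -/
theorem lintegral_split {T : ℝ} {H : Config × Config → ℝ≥0∞} (hH : Measurable H) :
    ∫⁻ c in orderedConfig T, ∫⁻ d in orderedConfig T, H (c, d) ∂configRef ∂configRef =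
      ∫⁻ W in orderedConfig T, ∑ I : Finset (Fin W.1), H (subConfig W I, subConfig W Iᶜ)
        ∂configRef := by
  let f : (k : ℕ) → Finset (Fin k) → ℝ≥0∞ := fun k I => ∫⁻ w : Fin k → ℝ,
    {w | IsOrderedIn T w}.indicator (fun w => H (subConfig ⟨k, w⟩ I, subConfig ⟨k, w⟩ Iᶜ)) w
  have hL : ∫⁻ c in orderedConfig T, ∫⁻ d in orderedConfig T, H (c, d) ∂configRef ∂configRef =
      ∑' n : ℕ, ∑' m : ℕ, ∑ I : Finset (Fin (n + m)), if I.card = n then f (n + m) I else 0 := by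
    rw [setLIntegral_orderedConfig hH.lintegral_prod_right']
    refine tsum_congr fun n => ?_
    have hm : ∀ m, Measurable fun p : (Fin n → ℝ) × (Fin m → ℝ) =>
        {t | IsOrderedIn T t}.indicator (1 : (Fin n → ℝ) → ℝ≥0∞) p.1 *
          ({u | IsOrderedIn T u}.indicator 1 p.2 * H (⟨n, p.1⟩, ⟨m, p.2⟩)) := fun m =>
      ((measurable_one.indicator (measurableSet_isOrderedIn T n)).comp measurable_fst).mul
        (((measurable_one.indicator (measurableSet_isOrderedIn T m)).comp measurable_snd).mul
          (hH.comp (((measurable_sigmaMk n).comp measurable_fst).prodMk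
            ((measurable_sigmaMk m).comp measurable_snd))))
    simp only [f, ← lintegral_split_fin hH]
    rw [← lintegral_tsum fun m => (hm m).lintegral_prod_right'.aemeasurable]
    refine lintegral_congr fun t => ?_
    by_cases ht : t ∈ {t : Fin n → ℝ | IsOrderedIn T t}
    · simp only [Set.indicator_of_mem ht, Pi.one_apply, one_mul]
      rw [setLIntegral_orderedConfig (f := fun d => H (⟨n, t⟩, d))
        (hH.comp measurable_prodMk_left)]
      refine tsum_congr fun m => lintegral_congr fun u => ?_
      by_cases hu : u ∈ {u : Fin m → ℝ | IsOrderedIn T u}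
      · simp [Set.indicator_of_mem hu]
      · simp [Set.indicator_of_notMem hu]
    · simp [Set.indicator_of_notMem ht]
  have hR : ∫⁻ W in orderedConfig T, ∑ I : Finset (Fin W.1), H (subConfig W I, subConfig W Iᶜ)
      ∂configRef = ∑' k : ℕ, ∑ I : Finset (Fin k), f k I := by
    rw [setLIntegral_orderedConfig (measurable_sum_subConfig hH)]
    refine tsum_congr fun k => ?_
    rw [← lintegral_finsetSum]
    · refine lintegral_congr fun w => ?_
      by_cases hw : w ∈ {w : Fin k → ℝ | IsOrderedIn T w}
      · simp only [Set.indicator_of_mem hw]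
      · simp only [Set.indicator_of_notMem hw, Finset.sum_const_zero]
    · exact fun I _ => (hH.comp ((measurable_subConfig I).prodMk
        (measurable_subConfig Iᶜ))).indicator (measurableSet_isOrderedIn T k)
  rw [hL, hR]
  -- The type of `I` depends on `n + m`. Introducing `k = n + m` as a further summation variable
  -- fixes that type; for given `k` and `I`, only `n = |I|` and `m = k - |I|` survive.
  calc _ = ∑' n : ℕ, ∑' m : ℕ, ∑' k : ℕ,
        if k = n + m then ∑ I : Finset (Fin k), (if I.card = n then f k I else 0) else 0 := by
        refine tsum_congr fun n => tsum_congr fun m => ?_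
        rw [tsum_eq_single (n + m) fun k hk => if_neg hk, if_pos rfl]
    _ = ∑' k : ℕ, ∑' n : ℕ, ∑' m : ℕ,
        if k = n + m then ∑ I : Finset (Fin k), (if I.card = n then f k I else 0) else 0 := by
        rw [ENNReal.tsum_comm]
        rw [tsum_congr fun m => ENNReal.tsum_comm, ENNReal.tsum_comm]
        exact tsum_congr fun k => ENNReal.tsum_comm
    _ = _ := by
        refine tsum_congr fun k => ?_
        have h : ∀ n m : ℕ, (if k = n + m then
            ∑ I : Finset (Fin k), (if I.card = n then f k I else 0) else 0) =
            ∑ I : Finset (Fin k), if k = n + m then (if I.card = n then f k I else 0) else 0 :=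
          fun n m => by split_ifs <;> simp
        simp only [h]
        rw [tsum_congr fun n => Summable.tsum_finsetSum fun I _ => ENNReal.summable,
          Summable.tsum_finsetSum fun I _ => ENNReal.summable]
        refine Finset.sum_congr rfl fun I _ => ?_
        have hIk : I.card ≤ k := (Finset.card_le_univ I).trans_eq (Fintype.card_fin k)
        rw [tsum_eq_single I.card fun n hn => ?_, tsum_eq_single (k - I.card) fun m hm => ?_]
        · rw [if_pos (by omega), if_pos rfl]
        · rw [if_neg (by omega)]
        · refine ENNReal.tsum_eq_zero.2 fun m => ?_
          rw [if_neg (Ne.symm hn), ite_self]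

end Split

end SymMH

namespace SymMH

/-! ### Poisson processes in exchangeable and in increasing order -/

section Poisson

theorem measurable_config_prod {α : Type*} [MeasurableSpace α] {ρ : α → ℝ → ℝ≥0∞}
    (hρ : Measurable (Function.uncurry ρ)) :
    Measurable fun p : α × Config => ∏ i, ρ p.1 (p.2.2 i) := by
  refine measurable_prod_sigma fun k => ?_
  change Measurable fun p : α × (Fin k → ℝ) => ∏ i, ρ p.1 (p.2 i)
  exact Finset.measurable_prod _ fun i _ => hρ.comp
    (measurable_fst.prodMk ((measurable_pi_apply i).comp measurable_snd))

theorem measurable_config_prod_const {ρ : ℝ → ℝ≥0∞} (hρ : Measurable ρ) :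
    Measurable fun c : Config => ∏ i, ρ (c.2 i) :=
  (measurable_config_prod (α := Unit) (ρ := fun _ => ρ) (hρ.comp measurable_snd)).comp
    (measurable_const (a := ()).prodMk measurable_id)

theorem measurable_inv_factorial :
    Measurable fun c : Config => ((c.1.factorial : ℝ≥0∞))⁻¹ :=
  measurable_sigma fun k =>
    (measurable_const : Measurable fun _ : Fin k → ℝ => (k.factorial : ℝ≥0∞)⁻¹)

variable {ρ : ℝ → ℝ≥0∞}

theorem lintegral_poissonProcess (hρ : Measurable ρ) (hfin : ∫⁻ t, ρ t ≠ ∞)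
    {f : Config → ℝ≥0∞} (hf : Measurable f) :
    ∫⁻ u, f u ∂ poissonProcess (volume.withDensity ρ) =
      ENNReal.ofReal (Real.exp (-(∫⁻ t, ρ t).toReal)) *
        ∫⁻ u, (u.1.factorial : ℝ≥0∞)⁻¹ * ((∏ i, ρ (u.2 i)) * f u) ∂configRef := by
  have := isFiniteMeasure_withDensity hfin
  have hprod := measurable_config_prod_const hρ
  have hall : Measurable fun u : Config =>
      (u.1.factorial : ℝ≥0∞)⁻¹ * ((∏ i, ρ (u.2 i)) * f u) :=
    measurable_inv_factorial.mul (hprod.mul hf)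
  rw [poissonProcess, lintegral_sum_measure, lintegral_configRef hall, ← ENNReal.tsum_mul_left]
  refine tsum_congr fun m => ?_
  have hfm : Measurable fun w : Fin m → ℝ => f ⟨m, w⟩ := hf.comp (measurable_sigmaMk m)
  have hpm : Measurable fun w : Fin m → ℝ => ∏ i, ρ (w i) := hprod.comp (measurable_sigmaMk m)
  rw [lintegral_smul_measure, lintegral_map hf (measurable_sigmaMk m), pi_withDensity m hρ,
    lintegral_withDensity_eq_lintegral_mul _ hpm hfm, withDensity_apply _ MeasurableSet.univ,
    Measure.restrict_univ, smul_eq_mul, div_eq_mul_inv, mul_assoc]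
  congr 1
  exact (lintegral_const_mul _ (hpm.mul hfm)).symm

/-- The part with `m` points has mass e^{-Λ} Λ^m / m!, and the exponential series sums these to one.
-/
theorem isProbabilityMeasure_poissonProcess (hρ : Measurable ρ) (hfin : ∫⁻ t, ρ t ≠ ∞) :
    IsProbabilityMeasure (poissonProcess (volume.withDensity ρ)) := by
  have hall : Measurable fun u : Config => (u.1.factorial : ℝ≥0∞)⁻¹ * ((∏ i, ρ (u.2 i)) * 1) :=
    measurable_inv_factorial.mul ((measurable_config_prod_const hρ).mul measurable_const)
  constructor
  rw [← lintegral_one, lintegral_poissonProcess hρ hfin measurable_const, lintegral_configRef hall]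
  set Λ := (∫⁻ t, ρ t).toReal with hΛ
  have h0 : 0 ≤ Λ := ENNReal.toReal_nonneg
  have h : ∀ m : ℕ, ∫⁻ w : Fin m → ℝ, ((m.factorial : ℝ≥0∞))⁻¹ * ((∏ i, ρ (w i)) * 1) =
      ENNReal.ofReal (Λ ^ m / m.factorial) := fun m => by
    have hm : Measurable fun w : Fin m → ℝ => (∏ i, ρ (w i)) * 1 :=
      (Finset.measurable_prod _ fun i _ => hρ.comp (measurable_pi_apply i)).mul measurable_const
    rw [lintegral_const_mul _ hm]
    simp only [mul_one]
    rw [lintegral_fin_prod m fun _ => hρ, Finset.prod_const, Finset.card_univ, Fintype.card_fin,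
      ENNReal.ofReal_div_of_pos (by positivity), ENNReal.ofReal_pow h0, hΛ,
      ENNReal.ofReal_toReal hfin, ENNReal.ofReal_natCast, mul_comm, div_eq_mul_inv]
  rw [tsum_congr h, ← ENNReal.ofReal_tsum_of_nonneg (fun m => by positivity)
    (Real.summable_pow_div_factorial Λ), ← ENNReal.ofReal_mul (Real.exp_nonneg _),
    ← congrFun NormedSpace.exp_eq_tsum_div Λ, ← Real.exp_eq_exp_ℝ, ← Real.exp_add, neg_add_cancel,
    Real.exp_zero, ENNReal.ofReal_one]

theorem pts_gridOf (F : Finset ℝ) : pts (gridOf F).2 = F := by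
  ext x
  rw [pts_mem, ← Finset.mem_coe (s := F), ← Finset.range_orderEmbOfFin F rfl]
  rfl

theorem pts_comp_equiv {m : ℕ} (x : Fin m → ℝ) (σ : Equiv.Perm (Fin m)) : pts (x ∘ σ) = pts x := by
  ext y
  rw [pts_mem, pts_mem]
  exact σ.exists_congr_left.trans (by simp)

/-- A Poisson process, listed in increasing order. -/
theorem lintegral_poissonProcess_gridOf (hρ : Measurable ρ) (hfin : ∫⁻ t, ρ t ≠ ∞) {T : ℝ}
    (hT : ∀ t, t ∉ Set.Icc 0 T → ρ t = 0) {g : Config → ℝ≥0∞} (hg : Measurable g) :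
    ∫⁻ u, g (gridOf (pts u.2)) ∂ poissonProcess (volume.withDensity ρ) =
      ENNReal.ofReal (Real.exp (-(∫⁻ t, ρ t).toReal)) *
        ∫⁻ u in orderedConfig T, (∏ i, ρ (u.2 i)) * g u ∂configRef := by
  have hg' : Measurable fun u : Config => g (gridOf (pts u.2)) :=
    hg.comp measurable_gridOf_pts_config
  have hprod := measurable_config_prod_const hρ
  have hall : Measurable fun u : Config =>
      (u.1.factorial : ℝ≥0∞)⁻¹ * ((∏ i, ρ (u.2 i)) * g (gridOf (pts u.2))) :=
    measurable_inv_factorial.mul (hprod.mul hg')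
  have hord : Measurable fun u : Config => (∏ i, ρ (u.2 i)) * g u := hprod.mul hg
  rw [lintegral_poissonProcess hρ hfin hg', setLIntegral_orderedConfig hord,
    lintegral_configRef hall]
  congr 1
  refine tsum_congr fun m => ?_
  have hF : Measurable fun w : Fin m → ℝ => (∏ i, ρ (w i)) * g (gridOf (pts w)) :=
    (hprod.mul hg').comp (measurable_sigmaMk m)
  dsimp only
  -- The integrand depends on the points only as an unordered family, so the `m!` orderings cancel
  -- the factor 1/m!.
  rw [lintegral_const_mul _ hF, lintegral_eq_factorial_mul_lintegral_ordered (T := T) hF,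
    ← mul_assoc, ENNReal.inv_mul_cancel (by positivity) (ENNReal.natCast_ne_top _), one_mul]
  · refine lintegral_congr fun w => ?_
    by_cases hw : IsOrderedIn T w
    · rw [Set.indicator_of_mem (show w ∈ {w | IsOrderedIn T w} from hw),
        Set.indicator_of_mem (show w ∈ {w | IsOrderedIn T w} from hw), gridOf_pts hw.1]
    · rw [Set.indicator_of_notMem (show w ∉ {w | IsOrderedIn T w} from hw),
        Set.indicator_of_notMem (show w ∉ {w | IsOrderedIn T w} from hw)]
  · intro σ x
    simp only [pts_comp_equiv, Function.comp_apply]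
    rw [Equiv.prod_comp σ fun i => ρ (x i)]
  · intro x i hi
    rw [Finset.prod_eq_zero (Finset.mem_univ i) (hT _ hi), zero_mul]

theorem measurable_poissonGridDensity {α : Type*} [MeasurableSpace α] (T : ℝ) {r : α → ℝ}
    (hr : Measurable r) : Measurable fun p : α × Config => poissonGridDensity T (r p.1) p.2 := by
  refine measurable_prod_sigma fun k => ?_
  refine Measurable.ite (measurable_snd (measurableSet_isOrderedIn T k)) ?_ measurable_const
  change Measurable fun p : α × (Fin k → ℝ) =>
    ENNReal.ofReal (r p.1 ^ k * Real.exp (-(r p.1 * T)))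
  have : Measurable fun p : α × (Fin k → ℝ) => r p.1 := hr.comp measurable_fst
  exact ((this.pow_const k).mul (this.mul_const T).neg.exp).ennreal_ofReal

/-- Claim (a): for the constant intensity `r` on `[0, T]` the total mass is `r T`, and each point of
an ordered tuple contributes a factor `r`. -/
theorem map_gridOf_poissonProcess_const {T r : ℝ} (hT : 0 < T) (hr : 0 ≤ r) :
    (poissonProcess (ENNReal.ofReal r • volume.restrict (Set.Icc 0 T))).map
        (fun u => gridOf (pts u.2)) =
      configRef.withDensity (poissonGridDensity T r) := by
  have hμ : ENNReal.ofReal r • volume.restrict (Set.Icc 0 T) =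
      volume.withDensity ((Set.Icc 0 T).indicator fun _ => ENNReal.ofReal r) := by
    rw [withDensity_indicator measurableSet_Icc, withDensity_const]
  have hρ : Measurable ((Set.Icc 0 T).indicator fun _ : ℝ => ENNReal.ofReal r) :=
    measurable_const.indicator measurableSet_Icc
  have hΛ : ∫⁻ t, (Set.Icc 0 T).indicator (fun _ => ENNReal.ofReal r) t = ENNReal.ofReal (r * T) := by
    rw [lintegral_indicator measurableSet_Icc, setLIntegral_const, Real.volume_Icc, sub_zero,
      ENNReal.ofReal_mul hr]
  have hO := measurableSet_orderedConfig T
  refine Measure.ext_of_lintegral _ fun g hg => ?_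
  have hmeas : Measurable (poissonGridDensity T r) :=
    (measurable_poissonGridDensity (α := Unit) T (r := fun _ => r) measurable_const).comp
      (measurable_const (a := ()).prodMk measurable_id)
  have hord : Measurable fun u : Config =>
      (∏ i, (Set.Icc 0 T).indicator (fun _ => ENNReal.ofReal r) (u.2 i)) * g u :=
    (measurable_config_prod_const hρ).mul hg
  rw [lintegral_map hg measurable_gridOf_pts_config, hμ, lintegral_poissonProcess_gridOf hρ
    (by rw [hΛ]; exact ENNReal.ofReal_ne_top) (fun t ht => Set.indicator_of_notMem ht _) hg, hΛ,
    ENNReal.toReal_ofReal (by positivity), lintegral_withDensity_eq_lintegral_mul _ hmeas hg,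
    ← lintegral_const_mul _ hord, ← lintegral_indicator hO]
  refine lintegral_congr fun u => ?_
  by_cases hu : u ∈ orderedConfig T
  · rw [Set.indicator_of_mem hu, Pi.mul_apply, poissonGridDensity, if_pos (show IsOrderedIn T u.2 from hu),
      Finset.prod_congr rfl fun i _ => Set.indicator_of_mem (Set.Ioo_subset_Icc_self (hu.2 i)) _,
      Finset.prod_const, Finset.card_univ, Fintype.card_fin, ENNReal.ofReal_mul (by positivity),
      ENNReal.ofReal_pow hr]
    ring
  · rw [Set.indicator_of_notMem hu, Pi.mul_apply, poissonGridDensity, if_neg (show ¬ IsOrderedIn T u.2 from hu), zero_mul]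

end Poisson

/-! ### Deleting self-transitions from a state sequence -/

section Compression

variable {N k : ℕ}

/-- The indices at which a sequence of states changes. -/
def jumps (v : Fin (k + 1) → Fin N) : Finset (Fin k) :=
  Finset.univ.filter fun i => v i.castSucc ≠ v i.succ

/-- The initial state followed by the states after the steps in `I`. -/
def compress (v : Fin (k + 1) → Fin N) (I : Finset (Fin k)) : Fin (I.card + 1) → Fin N :=
  Fin.cons (v 0) fun a => v (I.orderEmbOfFin rfl a).succ

/-- The number of elements of `I` before `i`. -/
def rank (I : Finset (Fin k)) (i : Fin (k + 1)) : Fin (I.card + 1) :=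
  ⟨(I.filter fun j : Fin k => (j : ℕ) < i).card, Nat.lt_succ_of_le (Finset.card_filter_le _ _)⟩

theorem rank_zero (I : Finset (Fin k)) : rank I 0 = 0 := by
  simp [rank]

theorem card_filter_orderEmbOfFin (I : Finset (Fin k)) (p : Fin k → Prop) [DecidablePred p] :
    (Finset.univ.filter fun a => p (I.orderEmbOfFin rfl a)).card = (I.filter p).card := by
  have h : I.filter p = (Finset.univ.filter fun a => p (I.orderEmbOfFin rfl a)).map
      (I.orderEmbOfFin rfl).toEmbedding := by
    ext i
    simp only [Finset.mem_filter, Finset.mem_map, Finset.mem_univ, true_and]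
    constructor
    · rintro ⟨hi, hp⟩
      have : i ∈ Set.range (I.orderEmbOfFin rfl) := by rwa [Finset.range_orderEmbOfFin]
      obtain ⟨a, rfl⟩ := this
      exact ⟨a, hp, rfl⟩
    · rintro ⟨a, hp, rfl⟩
      exact ⟨I.orderEmbOfFin_mem rfl a, hp⟩
  rw [h, Finset.card_map]

theorem rank_castSucc_orderEmbOfFin (I : Finset (Fin k)) (a : Fin I.card) :
    rank I (I.orderEmbOfFin rfl a).castSucc = a.castSucc := by
  ext
  simp only [rank, Fin.val_castSucc, Fin.val_fin_lt]
  rw [← card_filter_orderEmbOfFin I fun j => j < I.orderEmbOfFin rfl a]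
  simp [Finset.filter_gt_eq_Iio]

theorem rank_succ_orderEmbOfFin (I : Finset (Fin k)) (a : Fin I.card) :
    rank I (I.orderEmbOfFin rfl a).succ = a.succ := by
  ext
  simp only [rank, Fin.val_succ, Nat.lt_succ_iff, Fin.val_fin_le]
  rw [← card_filter_orderEmbOfFin I fun j => j ≤ I.orderEmbOfFin rfl a]
  simp [Finset.filter_ge_eq_Iic]

theorem rank_succ_of_notMem {I : Finset (Fin k)} {i : Fin k} (hi : i ∉ I) :
    rank I i.succ = rank I i.castSucc := by
  ext
  simp only [rank, Fin.val_succ, Fin.val_castSucc]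
  congr 1
  refine Finset.filter_congr fun j hj => ?_
  have : (j : ℕ) ≠ i := fun h => hi (Fin.ext h ▸ hj)
  omega

theorem exists_orderEmbOfFin_eq {I : Finset (Fin k)} {i : Fin k} (hi : i ∈ I) :
    ∃ a, I.orderEmbOfFin rfl a = i := by
  have : i ∈ Set.range (I.orderEmbOfFin rfl) := by rwa [Finset.range_orderEmbOfFin]
  exact this

theorem notMem_jumps {v : Fin (k + 1) → Fin N} {i : Fin k} (hi : i ∉ jumps v) :
    v i.castSucc = v i.succ := by
  simpa [jumps] using hi

/-- Steps outside `jumps v` change neither the rank nor the state, and each step inside advances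
both. Hence no information is lost by recording only the changes. -/
theorem compress_rank (v : Fin (k + 1) → Fin N) (i : Fin (k + 1)) :
    compress v (jumps v) (rank (jumps v) i) = v i := by
  induction i using Fin.induction with
  | zero => rw [rank_zero, compress, Fin.cons_zero]
  | succ i ih =>
    by_cases hi : i ∈ jumps v
    · obtain ⟨a, ha⟩ := exists_orderEmbOfFin_eq hi
      rw [← ha, rank_succ_orderEmbOfFin, compress, Fin.cons_succ]
    · rw [rank_succ_of_notMem hi, ih, notMem_jumps hi]

/-- Consecutive states must differ: a step of `I` with equal states on both sides would not be
visible in the expanded sequence. -/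
theorem jumps_comp_rank {I : Finset (Fin k)} {s : Fin (I.card + 1) → Fin N}
    (hs : ∀ a : Fin I.card, s a.castSucc ≠ s a.succ) : jumps (s ∘ rank I) = I := by
  ext i
  simp only [jumps, Finset.mem_filter, Finset.mem_univ, true_and, Function.comp_apply]
  by_cases hi : i ∈ I
  · obtain ⟨a, rfl⟩ := exists_orderEmbOfFin_eq hi
    rw [rank_succ_orderEmbOfFin, rank_castSucc_orderEmbOfFin]
    exact ⟨fun _ => hi, fun _ => hs a⟩
  · rw [rank_succ_of_notMem hi]
    exact ⟨fun h => absurd rfl h, fun h => absurd h hi⟩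

theorem compress_comp_rank (I : Finset (Fin k)) (s : Fin (I.card + 1) → Fin N) :
    compress (s ∘ rank I) I = s := by
  funext a
  refine Fin.cases ?_ (fun a => ?_) a
  · rw [compress, Fin.cons_zero, Function.comp_apply, rank_zero]
  · rw [compress, Fin.cons_succ, Function.comp_apply, rank_succ_orderEmbOfFin]

/-- Summation over jump sets and non-constant state sequences is summation over all state
sequences on the grid. -/
theorem sum_compress {R : Type*} [AddCommMonoid R]
    (G : (I : Finset (Fin k)) → (Fin (I.card + 1) → Fin N) → R)
    (hG : ∀ I s, ∀ a : Fin I.card, s a.castSucc = s a.succ → G I s = 0) :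
    ∑ I, ∑ s, G I s = ∑ v : Fin (k + 1) → Fin N, G (jumps v) (compress v (jumps v)) := by
  rw [Finset.sum_sigma']
  symm
  -- The inverse is `(I, s) ↦ s ∘ rank I`. A pair outside the image repeats a state at some step of
  -- `I`, so `G` vanishes there.
  refine Finset.sum_of_injOn (fun v => ⟨jumps v, compress v (jumps v)⟩) ?_ ?_ ?_ ?_
  · intro v _ v' _ h
    have hinv : ∀ v : Fin (k + 1) → Fin N, (fun x : Σ I : Finset (Fin k), Fin (I.card + 1) → Fin N =>
        x.2 ∘ rank x.1) ⟨jumps v, compress v (jumps v)⟩ = v := fun v => funext fun i =>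
      compress_rank v i
    rw [← hinv v, ← hinv v']
    exact congrArg (fun x : Σ I : Finset (Fin k), Fin (I.card + 1) → Fin N => x.2 ∘ rank x.1) h
  · intro v _
    simp
  · rintro ⟨I, s⟩ _ hx
    by_contra hne
    have hs : ∀ a : Fin I.card, s a.castSucc ≠ s a.succ := fun a ha => hne (hG I s a ha)
    refine hx ⟨s ∘ rank I, by simp, ?_⟩
    simp only
    rw [jumps_comp_rank hs, compress_comp_rank]
  · intro v _
    rfl

theorem compress_castSucc (v : Fin (k + 1) → Fin N) (a : Fin (jumps v).card) :
    compress v (jumps v) a.castSucc = v ((jumps v).orderEmbOfFin rfl a).castSucc := by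
  rw [← rank_castSucc_orderEmbOfFin, compress_rank]

theorem compress_succ (v : Fin (k + 1) → Fin N) (I : Finset (Fin k)) (a : Fin I.card) :
    compress v I a.succ = v (I.orderEmbOfFin rfl a).succ := rfl

/-- The indices with `w i ≤ x` form an initial segment, so their number decides which indices belong
to it. -/
theorem lt_intervalIndex_iff {w : Fin k → ℝ} (hw : StrictMono w) (x : ℝ) (j : Fin k) :
    (j : ℕ) < intervalIndex w x ↔ w j ≤ x := by
  simp only [intervalIndex]
  constructor
  · intro h
    by_contra hx
    have : (Finset.univ.filter fun i => w i ≤ x) ⊆ Finset.Iio j := fun i hi => by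
      rw [Finset.mem_filter] at hi
      rw [Finset.mem_Iio]
      exact hw.lt_iff_lt.1 (hi.2.trans_lt (not_le.1 hx))
    have := Finset.card_le_card this
    rw [Fin.card_Iio] at this
    omega
  · intro h
    have : Finset.Iic j ⊆ Finset.univ.filter fun i => w i ≤ x := fun i hi => by
      rw [Finset.mem_filter]
      exact ⟨Finset.mem_univ i, (hw.monotone (Finset.mem_Iic.1 hi)).trans h⟩
    have := Finset.card_le_card this
    rw [Fin.card_Iic] at this
    omega

theorem intervalIndex_eq_iff {w : Fin k → ℝ} (hw : StrictMono w) (x : ℝ) (i : Fin (k + 1)) :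
    intervalIndex w x = i ↔ ∀ j : Fin k, (j : ℕ) < i ↔ w j ≤ x := by
  constructor
  · rintro rfl j
    exact lt_intervalIndex_iff hw x j
  · intro h
    have h' : ∀ j : Fin k, (j : ℕ) < intervalIndex w x ↔ (j : ℕ) < i := fun j =>
      (lt_intervalIndex_iff hw x j).trans (h j).symm
    ext
    have h1 := (intervalIndex w x).isLt
    have h2 := i.isLt
    rcases lt_trichotomy (intervalIndex w x : ℕ) i with hlt | heq | hgt
    · exact absurd ((h' ⟨intervalIndex w x, by omega⟩).2 hlt) (lt_irrefl _)
    · exact heq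
    · exact absurd ((h' ⟨i, by omega⟩).1 hgt) (lt_irrefl _)

/-- Right-continuity: at a grid time the state after the transition already holds. -/
theorem intervalIndex_self {w : Fin k → ℝ} (hw : StrictMono w) (i : Fin k) :
    intervalIndex w (w i) = i.succ := by
  rw [intervalIndex_eq_iff hw]
  intro j
  rw [hw.le_iff_le, Fin.val_succ, Nat.lt_succ_iff, Fin.val_fin_le]

theorem intervalIndex_subConfig {w : Fin k → ℝ} (hw : StrictMono w) (I : Finset (Fin k)) (x : ℝ) :
    intervalIndex (fun a => w (I.orderEmbOfFin rfl a)) x = rank I (intervalIndex w x) := by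
  ext
  simp only [rank, lt_intervalIndex_iff hw]
  exact card_filter_orderEmbOfFin I fun j => w j ≤ x

/-- The trajectory with the jump times of `c` and the states `s`. -/
def pathOf (c : Config) (s : Fin (c.1 + 1) → Fin N) : Path N := ⟨c.1, (c.2, s)⟩

/-- Likelihood and thinning intensity use the trajectory only as a function of time; by this lemma
they can be evaluated on the full grid, before self-transitions are removed. -/
theorem stateAt_thin {w : Fin k → ℝ} (hw : StrictMono w) (v : Fin (k + 1) → Fin N) (x : ℝ) :
    stateAt (thin w v) x = v (intervalIndex w x) :=
  (congrArg (compress v (jumps v)) (intervalIndex_subConfig hw _ x)).trans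
    (compress_rank v _)

theorem prod_orderEmbOfFin {R : Type*} [CommMonoid R] (I : Finset (Fin k)) (f : Fin k → R) :
    ∏ a, f (I.orderEmbOfFin rfl a) = ∏ i ∈ I, f i := by
  conv_rhs => rw [← Finset.map_orderEmbOfFin_univ I rfl, Finset.prod_map]
  rfl

end Compression

end SymMH

namespace SymMH

/-! ### Measurable dependence on parameters and trajectories -/

theorem measurable_lintegral_poissonProcess {α : Type*} [MeasurableSpace α] {ρ : α → ℝ → ℝ≥0∞}
    (hρ : Measurable (Function.uncurry ρ)) (hfin : ∀ a, ∫⁻ t, ρ a t ≠ ∞)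
    {f : α × Config → ℝ≥0∞} (hf : Measurable f) :
    Measurable fun a => ∫⁻ u, f (a, u) ∂ poissonProcess (volume.withDensity (ρ a)) := by
  have hρa : ∀ a, Measurable (ρ a) := fun a => hρ.comp measurable_prodMk_left
  have hfa : ∀ a, Measurable fun u => f (a, u) := fun a => hf.comp measurable_prodMk_left
  simp only [fun a => lintegral_poissonProcess (hρa a) (hfin a) (hfa a)]
  have hint : Measurable fun p : α × Config =>
      (p.2.1.factorial : ℝ≥0∞)⁻¹ * ((∏ i, ρ p.1 (p.2.2 i)) * f p) :=
    (measurable_inv_factorial.comp measurable_snd).mul ((measurable_config_prod hρ).mul hf)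
  have hΛ : Measurable fun a => ∫⁻ t, ρ a t := hρ.lintegral_prod_right'
  exact (hΛ.ennreal_toReal.neg.exp.ennreal_ofReal).mul hint.lintegral_prod_right'

theorem measurable_prod_path {N : ℕ} {α γ : Type*} [MeasurableSpace α] [MeasurableSpace γ]
    {f : α × Path N → γ}
    (h : ∀ n (s : Fin (n + 1) → Fin N),
      Measurable fun p : α × (Fin n → ℝ) => f (p.1, ⟨n, (p.2, s)⟩)) : Measurable f := by
  refine measurable_prod_sigma fun n => ?_
  exact measurable_apply_of_countable
    (f := fun (p : α × (Fin n → ℝ) × (Fin (n + 1) → Fin N)) s => f (p.1, ⟨n, (p.2.1, s)⟩))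
    (i := fun p => p.2.2)
    (fun s => (h n s).comp (measurable_fst.prodMk (measurable_fst.comp measurable_snd)))
    (measurable_snd.comp measurable_snd)

/-! ### Integrals of piecewise constant functions -/

section Cells

variable {n : ℕ}

/-- The left end points of the intervals between the times `t`. -/
def leftEnd (t : Fin n → ℝ) : Fin (n + 1) → ℝ := Fin.cons 0 t

/-- The right end points of the intervals between the times `t`. -/
def rightEnd (T : ℝ) (t : Fin n → ℝ) : Fin (n + 1) → ℝ := Fin.snoc t T

theorem leftEnd_le_rightEnd {T : ℝ} (hT : 0 < T) {t : Fin n → ℝ} (ht : IsOrderedIn T t)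
    (i : Fin (n + 1)) : leftEnd t i ≤ rightEnd T t i := by
  refine Fin.cases ?_ (fun a => ?_) i
  · rw [leftEnd, Fin.cons_zero]
    refine Fin.lastCases (motive := fun i => 0 ≤ rightEnd T t i) ?_ (fun b => ?_) 0
    · rw [rightEnd, Fin.snoc_last]
      exact hT.le
    · rw [rightEnd, Fin.snoc_castSucc]
      exact (ht.2 b).1.le
  · rw [leftEnd, Fin.cons_succ]
    have key : ∀ i : Fin (n + 1), (a : ℕ) < i → t a ≤ rightEnd T t i := fun i =>
      Fin.lastCases (motive := fun i => (a : ℕ) < i → t a ≤ rightEnd T t i)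
        (fun _ => by
          rw [rightEnd, Fin.snoc_last]
          exact (ht.2 a).2.le)
        (fun b hb => by
          rw [rightEnd, Fin.snoc_castSucc]
          exact ht.1.monotone hb.le) i
    exact key a.succ (Nat.lt_succ_self _)

/-- The cell is squeezed between the half-open and the closed interval with these end points, which
have equal length. This avoids treating the last cell, which contains `T`, separately. -/
theorem volume_cell {T : ℝ} {t : Fin n → ℝ} (ht : IsOrderedIn T t)
    (i : Fin (n + 1)) :
    volume ({x | intervalIndex t x = i} ∩ Set.Icc 0 T) =
      ENNReal.ofReal (rightEnd T t i - leftEnd t i) := by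
  have hle0 : ∀ i, 0 ≤ leftEnd t i := fun i => by
    refine Fin.cases ?_ (fun a => ?_) i
    · exact le_refl _
    · exact (ht.2 a).1.le
  have hleT : ∀ i, rightEnd T t i ≤ T := fun i => by
    refine Fin.lastCases ?_ (fun a => ?_) i
    · rw [rightEnd, Fin.snoc_last]
    · rw [rightEnd, Fin.snoc_castSucc]
      exact (ht.2 a).2.le
  apply le_antisymm
  · rw [← Real.volume_Icc]
    refine measure_mono ?_
    rintro x ⟨hx, hx0, hxT⟩
    have h := (intervalIndex_eq_iff ht.1 x i).1 hx
    constructor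
    · revert h
      refine Fin.cases (fun _ => hx0) (fun a h => ?_) i
      exact (h a).1 (Nat.lt_succ_self _)
    · revert h
      refine Fin.lastCases (fun _ => ?_) (fun a h => ?_) i
      · rwa [rightEnd, Fin.snoc_last]
      · rw [rightEnd, Fin.snoc_castSucc]
        exact (not_le.1 fun hle => lt_irrefl _ ((h a).2 hle)).le
  · rw [← Real.volume_Ico]
    refine measure_mono ?_
    rintro x ⟨hxl, hxr⟩
    refine ⟨(intervalIndex_eq_iff ht.1 x i).2 fun j => ⟨fun hj => ?_, fun hj => ?_⟩,
      (hle0 i).trans hxl, (hxr.le).trans (hleT i)⟩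
    · revert hxl hj
      refine Fin.cases (fun _ h => absurd h (Nat.not_lt_zero _)) (fun a h hj => ?_) i
      rw [leftEnd, Fin.cons_succ] at h
      exact (ht.1.monotone (Nat.lt_succ_iff.1 hj)).trans h
    · by_contra hji
      revert hxr hji
      refine Fin.lastCases (fun _ h => h j.isLt) (fun a h hji => ?_) i
      rw [rightEnd, Fin.snoc_castSucc] at h
      exact absurd (hj.trans_lt h) (not_lt.2 (ht.1.monotone (not_lt.1 hji)))

theorem sum_rightEnd_sub_leftEnd (T : ℝ) (t : Fin n → ℝ) :
    ∑ i, (rightEnd T t i - leftEnd t i) = T := by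
  rw [Finset.sum_sub_distrib, Fin.sum_univ_castSucc, Fin.sum_univ_succ (leftEnd t)]
  simp [rightEnd, leftEnd]

/-- The integral of a piecewise constant function. -/
theorem lintegral_intervalIndex {T : ℝ} {t : Fin n → ℝ} (ht : IsOrderedIn T t)
    (c : Fin (n + 1) → ℝ≥0∞) :
    ∫⁻ x in Set.Icc 0 T, c (intervalIndex t x) =
      ∑ i, c i * ENNReal.ofReal (rightEnd T t i - leftEnd t i) := by
  have hmeas : Measurable fun x => intervalIndex t x :=
    (measurable_intervalIndex n).comp measurable_prodMk_left
  have hset : ∀ i, MeasurableSet {x | intervalIndex t x = i} := fun i =>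
    hmeas (measurableSet_singleton i)
  have h : ∀ x, c (intervalIndex t x) =
      ∑ i, {x | intervalIndex t x = i}.indicator (fun _ => c i) x := fun x => by
    rw [Finset.sum_eq_single (intervalIndex t x)]
    · rw [Set.indicator_of_mem (s := {y | intervalIndex t y = intervalIndex t x}) rfl]
    · intro i _ hi
      exact Set.indicator_of_notMem (s := {y | intervalIndex t y = i}) (fun h => hi h.symm) _
    · exact fun h => absurd (Finset.mem_univ _) h
  rw [lintegral_congr h, lintegral_finsetSum _ fun i _ => measurable_const.indicator (hset i)]
  refine Finset.sum_congr rfl fun i _ => ?_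
  rw [lintegral_indicator (hset i), setLIntegral_const, Measure.restrict_apply (hset i),
    volume_cell ht]

end Cells

/-! ### Densities of trajectories and of thinned times -/

namespace Model

variable {N m : ℕ} {Θ 𝒳 : Type*} [MeasurableSpace Θ] {lam : Measure Θ} (M : Model N m Θ 𝒳 lam)
  (X : Fin m → 𝒳)

/-- The density of the thinning intensity with respect to Lebesgue measure on the line. -/
noncomputable def thinRate (θ ϑ : Θ) (z : Path N) : ℝ → ℝ≥0∞ :=
  (Set.Icc 0 M.tEnd).indicator fun t =>
    ENNReal.ofReal (M.gridRate θ ϑ - M.exitRate θ (stateAt z t))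

theorem thinIntensity_eq (θ ϑ : Θ) (z : Path N) :
    M.thinIntensity θ ϑ z = volume.withDensity (M.thinRate θ ϑ z) :=
  (withDensity_indicator measurableSet_Icc _).symm

theorem measurable_thinRate {α : Type*} [MeasurableSpace α] {θ ϑ : α → Θ} {z : α → Path N}
    (hθ : Measurable θ) (hϑ : Measurable ϑ) (hz : Measurable z) :
    Measurable (Function.uncurry fun a => M.thinRate (θ a) (ϑ a) (z a)) := by
  have hexit : Measurable fun p : α × ℝ => M.exitRate (θ p.1) (stateAt (z p.1) p.2) :=
    measurable_apply_of_countable (f := fun (p : α × ℝ) s => M.exitRate (θ p.1) s)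
      (fun s => (M.measurable_exitRate s).comp (hθ.comp measurable_fst))
      ((measurable_stateAt N).comp ((hz.comp measurable_fst).prodMk measurable_snd))
  have hgrid : Measurable fun p : α × ℝ => M.gridRate (θ p.1) (ϑ p.1) :=
    M.measurable_gridRate.comp ((hθ.comp measurable_fst).prodMk (hϑ.comp measurable_fst))
  exact (hgrid.sub hexit).ennreal_ofReal.indicator (measurable_snd measurableSet_Icc)

theorem measurable_thinRate_apply (θ ϑ : Θ) (z : Path N) : Measurable (M.thinRate θ ϑ z) :=
  (M.measurable_thinRate (α := Unit) (measurable_const (a := θ)) (measurable_const (a := ϑ))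
    (measurable_const (a := z))).comp (measurable_const (a := ()).prodMk measurable_id)

theorem thinRate_of_notMem (θ ϑ : Θ) (z : Path N) (t : ℝ) (ht : t ∉ Set.Icc 0 M.tEnd) :
    M.thinRate θ ϑ z t = 0 := Set.indicator_of_notMem ht _

theorem lintegral_thinRate_ne_top (θ ϑ : Θ) (z : Path N) : ∫⁻ t, M.thinRate θ ϑ z t ≠ ∞ := by
  refine ((lintegral_mono fun t => ?_).trans_lt (?_ : ∫⁻ t,
    (Set.Icc 0 M.tEnd).indicator (fun _ => ENNReal.ofReal (M.gridRate θ ϑ)) t < ∞)).ne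
  · refine Set.indicator_le_indicator (ENNReal.ofReal_le_ofReal ?_)
    exact sub_le_self _ (M.exitRate_nonneg _ _)
  · rw [lintegral_indicator measurableSet_Icc, setLIntegral_const, Real.volume_Icc]
    exact ENNReal.mul_lt_top ENNReal.ofReal_lt_top ENNReal.ofReal_lt_top

/-- The off-diagonal part of the rate matrix. -/
def jumpRate (θ : Θ) (i j : Fin N) : ℝ := if i = j then 0 else M.rate θ i j

theorem jumpRate_nonneg (θ : Θ) (i j : Fin N) : 0 ≤ M.jumpRate θ i j := by
  unfold jumpRate
  split_ifs with h
  · exact le_rfl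
  · exact M.rate_nonneg θ i j h

theorem pathDensity_of_notMem (θ : Θ) {c : Config} (hc : ¬ IsOrderedIn M.tEnd c.2)
    (s : Fin (c.1 + 1) → Fin N) : M.pathDensity θ (pathOf c s) = 0 := if_neg hc

/-- The rate A_i of the exponential waiting time cancels the denominator of the jump probability
A_{ij} / A_i. The waiting factors and the survival factor of the last state combine to exp(-∫ A_S).
-/
theorem pathDensity_pathOf (θ : Θ) {c : Config} (hc : IsOrderedIn M.tEnd c.2)
    (s : Fin (c.1 + 1) → Fin N) :
    M.pathDensity θ (pathOf c s) =
      ENNReal.ofReal (M.init (s 0) * (∏ i : Fin c.1, M.jumpRate θ (s i.castSucc) (s i.succ)) *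
        Real.exp (-∑ i, M.exitRate θ (s i) * (rightEnd M.tEnd c.2 i - leftEnd c.2 i))) := by
  have hstep : ∀ i : Fin c.1, M.exitRate θ (s i.castSucc) *
      Real.exp (-(M.exitRate θ (s i.castSucc) * (leftEnd c.2 i.succ - leftEnd c.2 i.castSucc))) *
        M.jumpProb θ (s i.castSucc) (s i.succ) = M.jumpRate θ (s i.castSucc) (s i.succ) *
      Real.exp (-(M.exitRate θ (s i.castSucc) *
        (rightEnd M.tEnd c.2 i.castSucc - leftEnd c.2 i.castSucc))) := fun i => by
    rw [mul_right_comm, exitRate_mul_jumpProb, rightEnd, Fin.snoc_castSucc]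
    rfl
  rw [pathDensity, if_pos (show IsOrderedIn M.tEnd (pathOf c s).2.1 from hc)]
  congr 1
  rw [Fin.sum_univ_castSucc, neg_add, Real.exp_add, ← Finset.sum_neg_distrib, Real.exp_sum,
    ← mul_assoc, mul_assoc (M.init (s 0) : ℝ), ← Finset.prod_mul_distrib,
    ← Finset.prod_congr rfl fun i _ => hstep i, rightEnd, Fin.snoc_last]
  rfl

theorem lintegral_thinRate (θ ϑ : Θ) {c : Config} (hc : IsOrderedIn M.tEnd c.2)
    (s : Fin (c.1 + 1) → Fin N) :
    ∫⁻ t, M.thinRate θ ϑ (pathOf c s) t =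
      ENNReal.ofReal (M.gridRate θ ϑ * M.tEnd -
        ∑ i, M.exitRate θ (s i) * (rightEnd M.tEnd c.2 i - leftEnd c.2 i)) := by
  unfold thinRate
  rw [lintegral_indicator measurableSet_Icc]
  rw [show ∫⁻ t in Set.Icc 0 M.tEnd,
      ENNReal.ofReal (M.gridRate θ ϑ - M.exitRate θ (stateAt (pathOf c s) t)) = _ from
    lintegral_intervalIndex hc fun i => ENNReal.ofReal (M.gridRate θ ϑ - M.exitRate θ (s i))]
  have hr : ∀ i, 0 ≤ M.gridRate θ ϑ - M.exitRate θ (s i) := fun i =>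
    sub_nonneg.2 (M.exitRate_le_gridRate θ ϑ _)
  have hd : ∀ i, 0 ≤ rightEnd M.tEnd c.2 i - leftEnd c.2 i := fun i =>
    sub_nonneg.2 (leftEnd_le_rightEnd M.tEnd_pos hc i)
  simp only [← ENNReal.ofReal_mul (hr _)]
  rw [← ENNReal.ofReal_sum_of_nonneg fun i _ => mul_nonneg (hr i) (hd i)]
  congr 1
  rw [Finset.sum_congr rfl fun i _ => sub_mul _ _ _, Finset.sum_sub_distrib, ← Finset.mul_sum,
    sum_rightEnd_sub_leftEnd]

/-- The exponential factors of the path density and of the thinned process combine. -/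
theorem pathDensity_mul_exp (θ ϑ : Θ) {c : Config} (hc : IsOrderedIn M.tEnd c.2)
    (s : Fin (c.1 + 1) → Fin N) :
    M.pathDensity θ (pathOf c s) *
        ENNReal.ofReal (Real.exp (-(∫⁻ t, M.thinRate θ ϑ (pathOf c s) t).toReal)) =
      ENNReal.ofReal (M.init (s 0) * (∏ i : Fin c.1, M.jumpRate θ (s i.castSucc) (s i.succ)) *
        Real.exp (-(M.gridRate θ ϑ * M.tEnd))) := by
  have hnn : 0 ≤ M.gridRate θ ϑ * M.tEnd -
      ∑ i, M.exitRate θ (s i) * (rightEnd M.tEnd c.2 i - leftEnd c.2 i) := by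
    rw [← sum_rightEnd_sub_leftEnd M.tEnd c.2, Finset.mul_sum, ← Finset.sum_sub_distrib]
    simp only [sum_rightEnd_sub_leftEnd, ← sub_mul]
    exact Finset.sum_nonneg fun i _ => mul_nonneg (sub_nonneg.2 (M.exitRate_le_gridRate θ ϑ _))
      (sub_nonneg.2 (leftEnd_le_rightEnd M.tEnd_pos hc i))
  have hprod : 0 ≤ (M.init (s 0) : ℝ) * ∏ i : Fin c.1, M.jumpRate θ (s i.castSucc) (s i.succ) :=
    mul_nonneg (M.init (s 0)).2 (Finset.prod_nonneg fun i _ => M.jumpRate_nonneg θ _ _)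
  rw [pathDensity_pathOf M θ hc, lintegral_thinRate M θ ϑ hc, ENNReal.toReal_ofReal hnn,
    ← ENNReal.ofReal_mul (mul_nonneg hprod (Real.exp_nonneg _)), mul_assoc, ← Real.exp_add]
  congr 3
  ring

section Measurability

theorem measurable_pathDensity :
    Measurable fun p : Θ × Path N => M.pathDensity p.1 p.2 := by
  refine measurable_prod_path fun n s => ?_
  have hcons : ∀ i : Fin (n + 1),
      Measurable fun p : Θ × (Fin n → ℝ) => (Fin.cons 0 p.2 : Fin (n + 1) → ℝ) i := fun i => by
    refine Fin.cases ?_ (fun a => ?_) i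
    · exact measurable_const
    · exact (measurable_pi_apply a).comp measurable_snd
  have hexit : ∀ i, Measurable fun p : Θ × (Fin n → ℝ) => M.exitRate p.1 i := fun i =>
    (M.measurable_exitRate i).comp measurable_fst
  have hjump : ∀ i j, Measurable fun p : Θ × (Fin n → ℝ) => M.jumpProb p.1 i j := fun i j => by
    unfold jumpProb
    split_ifs
    · exact measurable_const
    · exact ((M.rate_meas i j).comp measurable_fst).div (hexit i)
  refine Measurable.ite (measurable_snd (measurableSet_isOrderedIn M.tEnd n)) ?_ measurable_const
  refine Measurable.ennreal_ofReal (Measurable.mul (Measurable.mul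
    (measurable_const : Measurable fun _ : Θ × (Fin n → ℝ) => (M.init (s 0) : ℝ)) ?_) ?_)
  · change Measurable fun p : Θ × (Fin n → ℝ) => ∏ i : Fin n, M.exitRate p.1 (s i.castSucc) *
      Real.exp (-(M.exitRate p.1 (s i.castSucc) * ((Fin.cons 0 p.2 : Fin (n + 1) → ℝ) i.succ -
        (Fin.cons 0 p.2 : Fin (n + 1) → ℝ) i.castSucc))) * M.jumpProb p.1 (s i.castSucc) (s i.succ)
    exact Finset.measurable_prod _ fun i _ => ((hexit _).mul
      ((hexit _).mul ((hcons _).sub (hcons _))).neg.exp).mul (hjump _ _)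
  · change Measurable fun p : Θ × (Fin n → ℝ) => Real.exp (-(M.exitRate p.1 (s (Fin.last n)) *
      (M.tEnd - (Fin.cons 0 p.2 : Fin (n + 1) → ℝ) (Fin.last n))))
    exact ((hexit _).mul (measurable_const.sub (hcons _))).neg.exp

theorem measurable_pathLik : Measurable fun p : Θ × Path N => M.pathLik X p.1 p.2 := by
  refine Finset.measurable_prod _ fun j _ => ?_
  exact measurable_apply_of_countable
    (f := fun (p : Θ × Path N) s => M.obsDensity j p.1 s (X j))
    (fun s => (M.obsDensity_meas j s (X j)).comp measurable_fst)
    ((measurable_stateAt N).comp (measurable_snd.prodMk measurable_const))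

end Measurability

/-- The observations are grouped by the grid interval containing their time, on which the state is
constant. -/
theorem pathLik_thin (θ : Θ) {W : Config} (hW : StrictMono W.2) (v : Fin (W.1 + 1) → Fin N) :
    M.pathLik X θ (thin W.2 v) = ∏ i : Fin (W.1 + 1), M.stepLik X θ W i (v i) := by
  simp only [pathLik, stateAt_thin hW, stepLik]
  rw [← Finset.prod_fiberwise Finset.univ fun j => intervalIndex W.2 (M.obsTime j)]
  refine Finset.prod_congr rfl fun i _ => ?_
  simp only [Fin.val_inj]
  refine Finset.prod_congr rfl fun j hj => ?_
  rw [(Finset.mem_filter.1 hj).2]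

/-- The weight of the jumps times the weight of the thinned times is the weight of the chain on the
grid. -/
theorem jumpRate_prod_mul_thinRate_prod (θ ϑ : Θ) {W : Config} (hW : IsOrderedIn M.tEnd W.2)
    (v : Fin (W.1 + 1) → Fin N) :
    ENNReal.ofReal (M.init (v 0) * (∏ i : Fin (jumps v).card,
        M.jumpRate θ (compress v (jumps v) i.castSucc) (compress v (jumps v) i.succ)) *
        Real.exp (-(M.gridRate θ ϑ * M.tEnd))) *
      ∏ i, M.thinRate θ ϑ (thin W.2 v) ((subConfig W (jumps v)ᶜ).2 i) =
    M.gridDensity θ ϑ W * (M.init (v 0) * ∏ i : Fin W.1, M.B θ ϑ (v i.castSucc) (v i.succ) : ℝ≥0) := by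
  -- At a genuine jump, the off-diagonal case of `gridRate_mul_B` applies.
  have h1 : ∏ i : Fin (jumps v).card,
      M.jumpRate θ (compress v (jumps v) i.castSucc) (compress v (jumps v) i.succ) =
      ∏ i ∈ jumps v, M.gridRate θ ϑ * M.B θ ϑ (v i.castSucc) (v i.succ) := by
    rw [← prod_orderEmbOfFin (jumps v) fun i =>
      M.gridRate θ ϑ * (M.B θ ϑ (v i.castSucc) (v i.succ) : ℝ)]
    refine Finset.prod_congr rfl fun a _ => ?_
    have hne : v ((jumps v).orderEmbOfFin rfl a).castSucc ≠ v ((jumps v).orderEmbOfFin rfl a).succ :=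
      (Finset.mem_filter.1 ((jumps v).orderEmbOfFin_mem rfl a)).2
    rw [compress_castSucc, compress_succ, gridRate_mul_B, jumpRate, if_neg hne, if_neg hne]
  have hR : ∀ i, 0 ≤ M.gridRate θ ϑ * (M.B θ ϑ (v (Fin.castSucc i)) (v i.succ) : ℝ) := fun i =>
    mul_nonneg (M.gridRate_nonneg θ ϑ) (NNReal.coe_nonneg _)
  -- At the other grid points the diagonal case applies. The intensity is evaluated at the state
  -- after the point, which equals the state before it.
  have h2 : ∏ i, M.thinRate θ ϑ (thin W.2 v) ((subConfig W (jumps v)ᶜ).2 i) =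
      ENNReal.ofReal (∏ i ∈ (jumps v)ᶜ, M.gridRate θ ϑ * M.B θ ϑ (v i.castSucc) (v i.succ)) := by
    rw [ENNReal.ofReal_prod_of_nonneg fun i _ => hR i, ← prod_orderEmbOfFin (jumps v)ᶜ fun i =>
      ENNReal.ofReal (M.gridRate θ ϑ * (M.B θ ϑ (v i.castSucc) (v i.succ) : ℝ))]
    refine Finset.prod_congr rfl fun a _ => ?_
    set i := (jumps v)ᶜ.orderEmbOfFin rfl a with hi
    have hmem : i ∉ jumps v := Finset.mem_compl.1 ((jumps v)ᶜ.orderEmbOfFin_mem rfl a)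
    have heq := notMem_jumps hmem
    change M.thinRate θ ϑ (thin W.2 v) (W.2 i) = _
    rw [thinRate, Set.indicator_of_mem (Set.Ioo_subset_Icc_self (hW.2 i)), stateAt_thin hW.1,
      intervalIndex_self hW.1, gridRate_mul_B, if_pos heq, heq]
  have hexp := Real.exp_nonneg (-(M.gridRate θ ϑ * M.tEnd))
  have hinit : (0 : ℝ) ≤ M.init (v 0) := NNReal.coe_nonneg _
  have hr := M.gridRate_nonneg θ ϑ
  rw [h1, h2, gridDensity, poissonGridDensity, if_pos hW, ← ENNReal.ofReal_coe_nnreal,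
    ← ENNReal.ofReal_mul (mul_nonneg (mul_nonneg hinit (Finset.prod_nonneg fun i _ => hR i)) hexp),
    ← ENNReal.ofReal_mul (by positivity)]
  congr 1
  have h3 : (∏ i ∈ jumps v, M.gridRate θ ϑ * (M.B θ ϑ (v i.castSucc) (v i.succ) : ℝ)) *
      ∏ i ∈ (jumps v)ᶜ, M.gridRate θ ϑ * (M.B θ ϑ (v i.castSucc) (v i.succ) : ℝ) =
      M.gridRate θ ϑ ^ W.1 * ∏ i, (M.B θ ϑ (v (Fin.castSucc i)) (v i.succ) : ℝ) := by
    rw [Finset.prod_mul_prod_compl, Finset.prod_mul_distrib, Finset.prod_const, Finset.card_univ,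
      Fintype.card_fin]
  push_cast
  calc _ = (M.init (v 0) : ℝ) * Real.exp (-(M.gridRate θ ϑ * M.tEnd)) *
        ((∏ i ∈ jumps v, M.gridRate θ ϑ * (M.B θ ϑ (v i.castSucc) (v i.succ) : ℝ)) *
        ∏ i ∈ (jumps v)ᶜ, M.gridRate θ ϑ * (M.B θ ϑ (v i.castSucc) (v i.succ) : ℝ)) := by ring
    _ = _ := by rw [h3]; ring

end Model

end SymMH

namespace SymMH

/-- Each stage of the sampler is known through its integrals of test functions; measurability of the
kernels is checked in the same form. -/
theorem measurable_measure_of_lintegral {α β : Type*} [MeasurableSpace α] [MeasurableSpace β]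
    {μ : α → Measure β} (h : ∀ f : β → ℝ≥0∞, Measurable f → Measurable fun a => ∫⁻ b, f b ∂μ a) :
    Measurable μ := by
  refine Measure.measurable_of_measurable_coe _ fun s hs => ?_
  have := h (s.indicator 1) (measurable_one.indicator hs)
  simpa only [lintegral_indicator_one hs] using this

namespace Model

variable {N m : ℕ} {Θ 𝒳 : Type*} [MeasurableSpace Θ] {lam : Measure Θ} (M : Model N m Θ 𝒳 lam)
  (X : Fin m → 𝒳)

/-! ### Thinning a trajectory against a Poisson process -/

theorem isProbabilityMeasure_poissonProcess_thinIntensity (θ ϑ : Θ) (z : Path N) :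
    IsProbabilityMeasure (poissonProcess (M.thinIntensity θ ϑ z)) := by
  rw [thinIntensity_eq]
  exact isProbabilityMeasure_poissonProcess (M.measurable_thinRate_apply θ ϑ z)
    (M.lintegral_thinRate_ne_top θ ϑ z)

theorem measurable_lintegral_thinned {α : Type*} [MeasurableSpace α] {θ ϑ : α → Θ} {z : α → Path N}
    (hθ : Measurable θ) (hϑ : Measurable ϑ) (hz : Measurable z) {f : α × Config → ℝ≥0∞}
    (hf : Measurable f) :
    Measurable fun a => ∫⁻ u, f (a, gridOf (pts (z a).2.1 ∪ pts u.2))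
      ∂ poissonProcess (M.thinIntensity (θ a) (ϑ a) (z a)) := by
  simp only [thinIntensity_eq]
  have hg : Measurable fun p : α × Config => gridOf (pts (z p.1).2.1 ∪ pts p.2.2) :=
    measurable_gridOf_union.comp
      (((measurable_path_times N).comp (hz.comp measurable_fst)).prodMk measurable_snd)
  exact measurable_lintegral_poissonProcess
    (f := fun p => f (p.1, gridOf (pts (z p.1).2.1 ∪ pts p.2.2)))
    (M.measurable_thinRate hθ hϑ hz)
    (fun a => M.lintegral_thinRate_ne_top (θ a) (ϑ a) (z a)) (hf.comp (measurable_fst.prodMk hg))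

/-- The density of the trajectory with jump times `c` and states `s`, with the exponential factor of
the whole Poisson grid of rate `Ω(θ) + Ω(ϑ)`. -/
noncomputable def jumpWeight (θ ϑ : Θ) (c : Config) (s : Fin (c.1 + 1) → Fin N) : ℝ≥0∞ :=
  ENNReal.ofReal (M.init (s 0) * (∏ i : Fin c.1, M.jumpRate θ (s i.castSucc) (s i.succ)) *
    Real.exp (-(M.gridRate θ ϑ * M.tEnd)))

/-- The density of the trajectory with jump times `c` and states `s`, of the observations and of the
thinned times `d`, times a test function of the grid and the trajectory. -/
noncomputable def splitTerm (θ ϑ : Θ) (Φ : Config × Path N → ℝ≥0∞) (c : Config)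
    (s : Fin (c.1 + 1) → Fin N) (d : Config) : ℝ≥0∞ :=
  M.jumpWeight θ ϑ c s * (M.pathLik X θ (pathOf c s) : ℝ≥0∞) *
    ((∏ i, M.thinRate θ ϑ (pathOf c s) (d.2 i)) * Φ (gridOf (pts c.2 ∪ pts d.2), pathOf c s))

theorem measurable_splitTerm (θ ϑ : Θ) {Φ : Config × Path N → ℝ≥0∞} (hΦ : Measurable Φ) (n : ℕ)
    (s : Fin (n + 1) → Fin N) :
    Measurable fun p : (Fin n → ℝ) × Config => M.splitTerm X θ ϑ Φ ⟨n, p.1⟩ s p.2 := by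
  have hp : Measurable fun w : Fin n → ℝ => (⟨n, (w, s)⟩ : Path N) :=
    (measurable_sigmaMk n).comp (measurable_id.prodMk measurable_const)
  have hr : Measurable fun p : (Fin n → ℝ) × Config =>
      ∏ i, M.thinRate θ ϑ ⟨n, (p.1, s)⟩ (p.2.2 i) :=
    measurable_config_prod (M.measurable_thinRate (measurable_const (a := θ))
      (measurable_const (a := ϑ)) hp)
  have hg : Measurable fun p : (Fin n → ℝ) × Config => gridOf (pts p.1 ∪ pts p.2.2) :=
    measurable_gridOf_union.comp (((measurable_sigmaMk n).comp measurable_fst).prodMk measurable_snd)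
  have hlik : Measurable fun p : (Fin n → ℝ) × Config =>
      (M.pathLik X θ ⟨n, (p.1, s)⟩ : ℝ≥0∞) :=
    ((M.measurable_pathLik X).comp
      (measurable_const.prodMk (hp.comp measurable_fst))).coe_nnreal_ennreal
  have hΦ' : Measurable fun p : (Fin n → ℝ) × Config =>
      Φ (gridOf (pts p.1 ∪ pts p.2.2), ⟨n, (p.1, s)⟩) :=
    hΦ.comp (hg.prodMk (hp.comp measurable_fst))
  -- Once the exponentials are combined, the weight depends on the states and the number of jumps
  -- but not on the times; the zero tuple is a dummy.
  have hw : Measurable fun p : (Fin n → ℝ) × Config => M.jumpWeight θ ϑ ⟨n, p.1⟩ s :=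
    (measurable_const : Measurable fun _ : (Fin n → ℝ) × Config => M.jumpWeight θ ϑ ⟨n, 0⟩ s)
  exact (hw.mul hlik).mul (hr.mul hΦ')

theorem measurable_sum_splitTerm (θ ϑ : Θ) {Φ : Config × Path N → ℝ≥0∞} (hΦ : Measurable Φ) :
    Measurable fun p : Config × Config =>
      ∑ s : Fin (p.1.1 + 1) → Fin N, M.splitTerm X θ ϑ Φ p.1 s p.2 := by
  refine measurable_sigma_prod fun n => ?_
  change Measurable fun p : (Fin n → ℝ) × Config =>
    ∑ s : Fin (n + 1) → Fin N, M.splitTerm X θ ϑ Φ ⟨n, p.1⟩ s p.2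
  exact Finset.measurable_sum _ fun s _ => M.measurable_splitTerm X θ ϑ hΦ n s

theorem measurable_splitTerm_right (θ ϑ : Θ) {Φ : Config × Path N → ℝ≥0∞} (hΦ : Measurable Φ)
    (c : Config) (s : Fin (c.1 + 1) → Fin N) : Measurable (M.splitTerm X θ ϑ Φ c s) := by
  have hg : Measurable fun d : Config => Φ (gridOf (pts c.2 ∪ pts d.2), pathOf c s) :=
    hΦ.comp ((measurable_gridOf_union.comp measurable_prodMk_left).prodMk measurable_const)
  exact ((measurable_config_prod_const (M.measurable_thinRate_apply θ ϑ (pathOf c s))).mul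
    hg).const_mul _

/-- Undoes the merging of the exponentials: `jumpWeight` is the path density times exp(-∫
intensity), and the latter is the normalizing factor of the Poisson process of thinned times. -/
theorem lintegral_splitTerm (θ ϑ : Θ) {Φ : Config × Path N → ℝ≥0∞} (hΦ : Measurable Φ) {c : Config}
    (hc : IsOrderedIn M.tEnd c.2) (s : Fin (c.1 + 1) → Fin N) :
    ∫⁻ d in orderedConfig M.tEnd, M.splitTerm X θ ϑ Φ c s d ∂configRef =
      M.pathDensity θ (pathOf c s) * (M.pathLik X θ (pathOf c s) : ℝ≥0∞) *
        ∫⁻ u, Φ (gridOf (pts c.2 ∪ pts u.2), pathOf c s)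
          ∂ poissonProcess (M.thinIntensity θ ϑ (pathOf c s)) := by
  have hg : Measurable fun d : Config => Φ (gridOf (pts c.2 ∪ pts d.2), pathOf c s) :=
    hΦ.comp ((measurable_gridOf_union.comp measurable_prodMk_left).prodMk measurable_const)
  have hcs : Measurable fun d : Config => (∏ i, M.thinRate θ ϑ (pathOf c s) (d.2 i)) *
      Φ (gridOf (pts c.2 ∪ pts d.2), pathOf c s) :=
    (measurable_config_prod_const (M.measurable_thinRate_apply θ ϑ _)).mul hg
  have h := lintegral_poissonProcess_gridOf (M.measurable_thinRate_apply θ ϑ (pathOf c s))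
    (M.lintegral_thinRate_ne_top θ ϑ (pathOf c s)) (M.thinRate_of_notMem θ ϑ (pathOf c s)) hg
  simp only [pts_gridOf] at h
  unfold splitTerm
  rw [lintegral_const_mul _ hcs, thinIntensity_eq, h, jumpWeight, ← M.pathDensity_mul_exp θ ϑ hc s]
  ring

/-- The combinatorial half of the identity, on a fixed grid: `I` marks the genuine jumps, and
`sum_compress` trades `(I, s)` for a state sequence on the whole grid. Terms with a repeated state
drop out because `jumpRate` vanishes on the diagonal. -/
theorem sum_splitTerm (θ ϑ : Θ) (Φ : Config × Path N → ℝ≥0∞) {W : Config}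
    (hW : IsOrderedIn M.tEnd W.2) :
    ∑ I : Finset (Fin W.1), ∑ s : Fin (I.card + 1) → Fin N,
        M.splitTerm X θ ϑ Φ (subConfig W I) s (subConfig W Iᶜ) =
      M.gridDensity θ ϑ W * ∑ v : Fin (W.1 + 1) → Fin N,
        (chainWeight M.init (M.B θ ϑ) (M.stepLik X θ W) W.1 v : ℝ≥0∞) * Φ (W, thin W.2 v) := by
  rw [sum_compress (fun I s => M.splitTerm X θ ϑ Φ (subConfig W I) s (subConfig W Iᶜ)),
    Finset.mul_sum]
  · refine Finset.sum_congr rfl fun v _ => ?_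
    have hpath : pathOf (subConfig W (jumps v)) (compress v (jumps v)) = thin W.2 v := rfl
    have hgrid : gridOf (pts (subConfig W (jumps v)).2 ∪ pts (subConfig W (jumps v)ᶜ).2) = W := by
      rw [pts_subConfig, pts_subConfig, ← Finset.image_union, Finset.union_compl]
      exact gridOf_pts hW.1
    have hw : M.jumpWeight θ ϑ (subConfig W (jumps v)) (compress v (jumps v)) *
        ∏ i, M.thinRate θ ϑ (thin W.2 v) ((subConfig W (jumps v)ᶜ).2 i) =
        M.gridDensity θ ϑ W *
          (M.init (v 0) * ∏ i : Fin W.1, M.B θ ϑ (v i.castSucc) (v i.succ) : ℝ≥0) :=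
      M.jumpRate_prod_mul_thinRate_prod θ ϑ hW v
    unfold splitTerm
    rw [hpath, hgrid, chainWeight, ENNReal.coe_mul, ← M.pathLik_thin X θ hW.1 v]
    have key : ∀ a b c d x y : ℝ≥0∞, a * c = x * y → a * b * (c * d) = x * (y * b * d) :=
      fun a b c d x y h => by rw [mul_mul_mul_comm, h]; ring
    exact key _ _ _ _ _ _ hw
  · intro I s a ha
    have : M.jumpWeight θ ϑ (subConfig W I) s = 0 := by
      have h0 : ∏ i : Fin I.card, M.jumpRate θ (s i.castSucc) (s i.succ) = 0 :=
        Finset.prod_eq_zero (Finset.mem_univ a) (if_pos ha)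
      change ENNReal.ofReal (M.init (s 0) * (∏ i : Fin I.card,
        M.jumpRate θ (s i.castSucc) (s i.succ)) * _) = 0
      rw [h0, mul_zero, zero_mul, ENNReal.ofReal_zero]
    exact mul_eq_zero_of_left (mul_eq_zero_of_left this _) _

/-- The joint law of the grid and the trajectory, when thinned times are added to the trajectory, is
that of a Poisson grid with a Markov chain on it. -/
theorem lintegral_thinned (θ ϑ : Θ) {Φ : Config × Path N → ℝ≥0∞} (hΦ : Measurable Φ) :
    ∫⁻ z, M.pathDensity θ z * (M.pathLik X θ z : ℝ≥0∞) *
        ∫⁻ u, Φ (gridOf (pts z.2.1 ∪ pts u.2), z) ∂ poissonProcess (M.thinIntensity θ ϑ z)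
        ∂pathRef N =
      ∫⁻ W, M.gridDensity θ ϑ W * ∑ v : Fin (W.1 + 1) → Fin N,
        (chainWeight M.init (M.B θ ϑ) (M.stepLik X θ W) W.1 v : ℝ≥0∞) * Φ (W, thin W.2 v)
        ∂configRef := by
  have hdens : Measurable fun z : Path N => M.pathDensity θ z :=
    M.measurable_pathDensity.comp measurable_prodMk_left
  have hlik : Measurable fun z : Path N => (M.pathLik X θ z : ℝ≥0∞) :=
    ((M.measurable_pathLik X).comp measurable_prodMk_left).coe_nnreal_ennreal
  have hO := measurableSet_orderedConfig M.tEnd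
  have hLHS : Measurable fun z : Path N => M.pathDensity θ z * (M.pathLik X θ z : ℝ≥0∞) *
      ∫⁻ u, Φ (gridOf (pts z.2.1 ∪ pts u.2), z) ∂ poissonProcess (M.thinIntensity θ ϑ z) :=
    (hdens.mul hlik).mul (M.measurable_lintegral_thinned (f := fun p => Φ (p.2, p.1))
      measurable_const measurable_const measurable_id (hΦ.comp measurable_swap))
  have hH := M.measurable_sum_splitTerm X θ ϑ hΦ
  rw [lintegral_pathRef hLHS]
  -- The path density vanishes off ordered jump times and the Poisson points are almost surely
  -- ordered after sorting, so both integrals are over ordered grids, as `lintegral_split` requires.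
  calc _ = ∫⁻ c in orderedConfig M.tEnd, ∫⁻ d in orderedConfig M.tEnd,
        ∑ s : Fin (c.1 + 1) → Fin N, M.splitTerm X θ ϑ Φ c s d ∂configRef ∂configRef := by
        rw [← lintegral_indicator hO]
        refine lintegral_congr fun c => ?_
        by_cases hc : c ∈ orderedConfig M.tEnd
        · rw [Set.indicator_of_mem hc,
            lintegral_finsetSum _ fun s _ => M.measurable_splitTerm_right X θ ϑ hΦ c s]
          exact Finset.sum_congr rfl fun s _ => (M.lintegral_splitTerm X θ ϑ hΦ hc s).symm
        · rw [Set.indicator_of_notMem hc]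
          refine Finset.sum_eq_zero fun s _ => ?_
          rw [show M.pathDensity θ ⟨c.1, (c.2, s)⟩ = 0 from M.pathDensity_of_notMem θ hc s, zero_mul,
            zero_mul]
    _ = _ := by
        rw [lintegral_split hH, ← lintegral_indicator hO]
        refine lintegral_congr fun W => ?_
        by_cases hW : W ∈ orderedConfig M.tEnd
        · rw [Set.indicator_of_mem hW]
          exact M.sum_splitTerm X θ ϑ Φ hW
        · rw [Set.indicator_of_notMem hW, gridDensity, poissonGridDensity,
            if_neg (show ¬ IsOrderedIn M.tEnd W.2 from hW), zero_mul]

end Model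

end SymMH

namespace SymMH

namespace Model

variable {N m : ℕ} {Θ 𝒳 : Type*} [MeasurableSpace Θ] {lam : Measure Θ} (M : Model N m Θ 𝒳 lam)
  (X : Fin m → 𝒳)

/-! ### The three stages as kernels -/

section Augment

/-- The law of `(θ, ϑ, W)` when `ϑ` has been drawn. -/
noncomputable def gridLaw (p : (Θ × Path N) × Θ) : Measure (Θ × Θ × Config) :=
  (poissonProcess (M.thinIntensity p.1.1 p.2 p.1.2)).map fun u =>
    (p.1.1, p.2, gridOf (pts p.1.2.2.1 ∪ pts u.2))

theorem measurable_gridLaw_map (p : (Θ × Path N) × Θ) :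
    Measurable fun u : Config => (p.1.1, p.2, gridOf (pts p.1.2.2.1 ∪ pts u.2)) :=
  measurable_const.prodMk (measurable_const.prodMk
    (measurable_gridOf_union.comp (measurable_prodMk_left (x := (⟨p.1.2.1, p.1.2.2.1⟩ : Config)))))

theorem lintegral_gridLaw (p : (Θ × Path N) × Θ) {f : Θ × Θ × Config → ℝ≥0∞} (hf : Measurable f) :
    ∫⁻ x, f x ∂M.gridLaw p = ∫⁻ u, f (p.1.1, p.2, gridOf (pts p.1.2.2.1 ∪ pts u.2))
      ∂ poissonProcess (M.thinIntensity p.1.1 p.2 p.1.2) :=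
  lintegral_map hf (measurable_gridLaw_map p)

theorem measurable_lintegral_gridLaw {f : Θ × Θ × Config → ℝ≥0∞} (hf : Measurable f) :
    Measurable fun p : (Θ × Path N) × Θ => ∫⁻ x, f x ∂M.gridLaw p := by
  simp only [M.lintegral_gridLaw _ hf]
  have hf' : Measurable fun q : ((Θ × Path N) × Θ) × Config => f (q.1.1.1, q.1.2, q.2) :=
    hf.comp (measurable_fst.fst.fst.prodMk (measurable_fst.snd.prodMk measurable_snd))
  exact M.measurable_lintegral_thinned measurable_fst.fst measurable_snd measurable_fst.snd hf'

theorem measurable_gridLaw : Measurable (M.gridLaw (N := N)) :=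
  measurable_measure_of_lintegral fun _ hf => M.measurable_lintegral_gridLaw hf

theorem measurable_prop_right (θ : Θ) : Measurable fun ϑ => (M.prop θ ϑ : ℝ≥0∞) :=
  (M.prop_meas.comp measurable_prodMk_left).coe_nnreal_ennreal

theorem lintegral_augment (y : Θ × Path N) {f : Θ × Θ × Config → ℝ≥0∞} (hf : Measurable f) :
    ∫⁻ x, f x ∂M.augment y = ∫⁻ ϑ, M.prop y.1 ϑ * ∫⁻ x, f x ∂M.gridLaw (y, ϑ) ∂lam := by
  have hκ : Measurable fun ϑ => M.gridLaw (y, ϑ) := M.measurable_gridLaw.comp measurable_prodMk_left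
  have hQ : Measurable fun ϑ => ∫⁻ x, f x ∂M.gridLaw (y, ϑ) :=
    (M.measurable_lintegral_gridLaw hf).comp measurable_prodMk_left
  change ∫⁻ x, f x ∂(lam.withDensity fun ϑ => (M.prop y.1 ϑ : ℝ≥0∞)).bind
    (fun ϑ => M.gridLaw (y, ϑ)) = _
  rw [Measure.lintegral_bind hκ.aemeasurable hf.aemeasurable,
    lintegral_withDensity_eq_lintegral_mul _ (M.measurable_prop_right y.1) hQ]
  rfl

theorem measurable_augment [SFinite lam] : Measurable M.augment := by
  refine measurable_measure_of_lintegral fun f hf => ?_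
  simp only [M.lintegral_augment _ hf]
  have h : Measurable fun p : (Θ × Path N) × Θ =>
      (M.prop p.1.1 p.2 : ℝ≥0∞) * ∫⁻ x, f x ∂M.gridLaw p :=
    (M.prop_meas.comp (measurable_fst.fst.prodMk measurable_snd)).coe_nnreal_ennreal.mul
      (M.measurable_lintegral_gridLaw hf)
  exact h.lintegral_prod_right'

theorem isProbabilityMeasure_gridLaw (p : (Θ × Path N) × Θ) :
    IsProbabilityMeasure (M.gridLaw p) := by
  have := M.isProbabilityMeasure_poissonProcess_thinIntensity p.1.1 p.2 p.1.2
  exact Measure.isProbabilityMeasure_map (measurable_gridLaw_map p).aemeasurable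

theorem isProbabilityMeasure_augment (y : Θ × Path N) : IsProbabilityMeasure (M.augment y) := by
  constructor
  have h : ∀ ϑ, ∫⁻ _, 1 ∂M.gridLaw (y, ϑ) = 1 := fun ϑ => by
    have := M.isProbabilityMeasure_gridLaw (y, ϑ)
    rw [lintegral_one, measure_univ]
  rw [← lintegral_one, M.lintegral_augment y measurable_const]
  simp only [h, mul_one]
  exact M.prop_int y.1

end Augment

section Accept

theorem measurable_swap_params : Measurable (swap : Θ × Θ × Config → Θ × Θ × Config) :=
  measurable_snd.fst.prodMk (measurable_fst.prodMk measurable_snd.snd)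

theorem measurable_accept : Measurable (M.accept X) := by
  have hlik := M.measurable_gridLik X
  have hnum : Measurable fun y : Θ × Θ × Config =>
      M.gridLik X y.1 y.2.1 y.2.2 * M.prior y.1 * M.prop y.1 y.2.1 :=
    (hlik.mul (M.prior_meas.comp measurable_fst)).mul
      (M.prop_meas.comp (measurable_fst.prodMk measurable_snd.fst))
  -- The numerator of the ratio is the denominator at the swapped point.
  have h : M.accept X = fun y => min 1
      ((M.gridLik X (swap y).1 (swap y).2.1 (swap y).2.2 * M.prior (swap y).1 *
        M.prop (swap y).1 (swap y).2.1) / (M.gridLik X y.1 y.2.1 y.2.2 * M.prior y.1 *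
          M.prop y.1 y.2.1)) := by
    funext y
    simp only [accept, forwardLik_eq_gridLik, swap]
  rw [h]
  exact measurable_const.min ((hnum.comp measurable_swap_params).div hnum)

theorem accept_le_one (y : Θ × Θ × Config) : M.accept X y ≤ 1 := min_le_left _ _

theorem lintegral_mhStep (y : Θ × Θ × Config) {f : Θ × Θ × Config → ℝ≥0∞} (hf : Measurable f) :
    ∫⁻ x, f x ∂M.mhStep X y =
      M.accept X y * f (swap y) + ((1 - M.accept X y : ℝ≥0) : ℝ≥0∞) * f y := by
  rw [mhStep, lintegral_add_measure, lintegral_smul_measure, lintegral_smul_measure,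
    lintegral_dirac' _ hf, lintegral_dirac' _ hf, smul_eq_mul, smul_eq_mul]

theorem measurable_mhStep : Measurable (M.mhStep X) := by
  refine measurable_measure_of_lintegral fun f hf => ?_
  simp only [M.lintegral_mhStep X _ hf]
  have ha := M.measurable_accept X
  exact (ha.coe_nnreal_ennreal.mul (hf.comp measurable_swap_params)).add
    ((measurable_const.sub ha).coe_nnreal_ennreal.mul hf)

theorem isProbabilityMeasure_mhStep (y : Θ × Θ × Config) : IsProbabilityMeasure (M.mhStep X y) := by
  constructor
  rw [← lintegral_one, M.lintegral_mhStep X y measurable_const, mul_one, mul_one,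
    ← ENNReal.coe_add, add_tsub_cancel_of_le (M.accept_le_one X y), ENNReal.coe_one]

end Accept

section Resample

theorem lintegral_resample (y : Θ × Θ × Config) {f : Θ × Path N → ℝ≥0∞} (hf : Measurable f) :
    ∫⁻ x, f x ∂M.resample X y = ∑ v : Fin (y.2.2.1 + 1) → Fin N,
      (backwardProb M.init (M.B y.1 y.2.1) (M.stepLik X y.1 y.2.2) y.2.2.1 v : ℝ≥0∞) *
        f (y.1, thin y.2.2.2 v) := by
  simp only [resample, lintegral_finsetSum_measure, lintegral_smul_measure, lintegral_dirac' _ hf,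
    smul_eq_mul]

theorem measurable_thin {k : ℕ} (v : Fin (k + 1) → Fin N) :
    Measurable fun w : Fin k → ℝ => thin w v :=
  (measurable_sigmaMk (jumps v).card).comp
    ((measurable_pi_lambda (fun (w : Fin k → ℝ) a => w ((jumps v).orderEmbOfFin rfl a))
      fun _ => measurable_pi_apply _).prodMk measurable_const)

theorem measurable_resample : Measurable (M.resample X) := by
  refine measurable_measure_of_lintegral fun f hf => ?_
  simp only [M.lintegral_resample X _ hf]
  refine measurable_prod_config fun k => ?_
  change Measurable fun p : Θ × Θ × (Fin k → ℝ) => ∑ v : Fin (k + 1) → Fin N,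
    (backwardProb M.init (M.B p.1 p.2.1) (M.stepLik X p.1 ⟨k, p.2.2⟩) k v : ℝ≥0∞) *
      f (p.1, thin p.2.2 v)
  exact Finset.measurable_sum _ fun v _ =>
    (M.measurable_backwardProb_model X k v).coe_nnreal_ennreal.mul
      (hf.comp (measurable_fst.prodMk ((measurable_thin v).comp measurable_snd.snd)))

theorem isProbabilityMeasure_resample (y : Θ × Θ × Config) :
    IsProbabilityMeasure (M.resample X y) := by
  have := M.neZero
  constructor
  rw [← lintegral_one, M.lintegral_resample X y measurable_const]
  simp only [mul_one]
  rw [← ENNReal.ofNNReal_finsetSum, sum_backwardProb, ENNReal.coe_one]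

end Resample

section Step

theorem measurable_step [SFinite lam] : Measurable (M.step X) :=
  (Measure.measurable_bind' (M.measurable_resample X)).comp
    ((Measure.measurable_bind' (M.measurable_mhStep X)).comp M.measurable_augment)

theorem isProbabilityMeasure_step (y : Θ × Path N) : IsProbabilityMeasure (M.step X y) := by
  have h1 := M.isProbabilityMeasure_augment y
  have h2 := M.isProbabilityMeasure_mhStep X
  have h3 := M.isProbabilityMeasure_resample X
  constructor
  rw [step, Measure.bind_apply MeasurableSet.univ (M.measurable_resample X).aemeasurable]
  simp only [measure_univ, lintegral_one]
  rw [Measure.bind_apply MeasurableSet.univ (M.measurable_mhStep X).aemeasurable]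
  simp only [measure_univ, lintegral_one]

end Step

/-! ### The extended target -/

section Target

theorem measurable_gridDensity :
    Measurable fun y : Θ × Θ × Config => M.gridDensity y.1 y.2.1 y.2.2 :=
  (measurable_poissonGridDensity M.tEnd M.measurable_gridRate).comp
    ((measurable_fst.prodMk measurable_snd.fst).prodMk measurable_snd.snd)

theorem measurable_extendedDensity : Measurable (M.extendedDensity X) :=
  (((M.prior_meas.comp measurable_fst).coe_nnreal_ennreal.mul
    (M.prop_meas.comp (measurable_fst.prodMk measurable_snd.fst)).coe_nnreal_ennreal).mul
      M.measurable_gridDensity).mul (M.measurable_gridLik X).coe_nnreal_ennreal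

theorem measurable_joint : Measurable fun y : Θ × Path N =>
    (M.prior y.1 : ℝ≥0∞) * M.pathDensity y.1 y.2 * (M.pathLik X y.1 y.2 : ℝ≥0∞) :=
  ((M.prior_meas.comp measurable_fst).coe_nnreal_ennreal.mul M.measurable_pathDensity).mul
    (M.measurable_pathLik X).coe_nnreal_ennreal

theorem lintegral_jointLaw {f : Θ × Path N → ℝ≥0∞} (hf : Measurable f) :
    ∫⁻ y, f y ∂M.jointLaw X = ∫⁻ θ, ∫⁻ z, (M.prior θ : ℝ≥0∞) * M.pathDensity θ z *
      (M.pathLik X θ z : ℝ≥0∞) * f (θ, z) ∂pathRef N ∂lam := by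
  rw [jointLaw, lintegral_withDensity_eq_lintegral_mul _ (M.measurable_joint X) hf,
    lintegral_prod _ ((M.measurable_joint X).mul hf).aemeasurable]
  rfl

/-- The law of `(θ, ϑ, W)` in stationarity, up to normalization. -/
noncomputable def extendedLaw : Measure (Θ × Θ × Config) :=
  (lam.prod (lam.prod configRef)).withDensity (M.extendedDensity X)

theorem lintegral_extendedLaw [SFinite lam] {f : Θ × Θ × Config → ℝ≥0∞} (hf : Measurable f) :
    ∫⁻ y, f y ∂M.extendedLaw X = ∫⁻ θ, ∫⁻ ϑ, ∫⁻ W, M.extendedDensity X (θ, ϑ, W) * f (θ, ϑ, W)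
      ∂configRef ∂lam ∂lam := by
  have h := (M.measurable_extendedDensity X).mul hf
  rw [extendedLaw, lintegral_withDensity_eq_lintegral_mul _ (M.measurable_extendedDensity X) hf,
    lintegral_prod _ h.aemeasurable]
  exact lintegral_congr fun θ => lintegral_prod _ (h.comp measurable_prodMk_left).aemeasurable

/-- Drawing the proposal and the grid from the joint law of parameter, trajectory and observations
gives the extended target. -/
theorem jointLaw_bind_augment [SFinite lam] :
    (M.jointLaw X).bind M.augment = M.extendedLaw X := by
  refine Measure.ext_of_lintegral _ fun f hf => ?_
  have hQ := M.measurable_lintegral_gridLaw hf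
  have haug : Measurable fun y => ∫⁻ x, f x ∂M.augment y :=
    (Measure.measurable_lintegral hf).comp M.measurable_augment
  rw [Measure.lintegral_bind M.measurable_augment.aemeasurable hf.aemeasurable,
    M.lintegral_jointLaw X haug, M.lintegral_extendedLaw X hf]
  refine lintegral_congr fun θ => ?_
  have hprop := M.measurable_prop_right θ
  have hj : Measurable fun z : Path N => (M.prior θ : ℝ≥0∞) * M.pathDensity θ z *
      (M.pathLik X θ z : ℝ≥0∞) := (M.measurable_joint X).comp measurable_prodMk_left
  have hQ' : Measurable fun p : Path N × Θ => ∫⁻ x, f x ∂M.gridLaw ((θ, p.1), p.2) :=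
    hQ.comp ((measurable_const.prodMk measurable_fst).prodMk measurable_snd)
  have hpQ : Measurable fun p : Path N × Θ =>
      (M.prop θ p.2 : ℝ≥0∞) * ∫⁻ x, f x ∂M.gridLaw ((θ, p.1), p.2) :=
    (hprop.comp measurable_snd).mul hQ'
  calc _ = ∫⁻ z, ∫⁻ ϑ, (M.prior θ : ℝ≥0∞) * M.pathDensity θ z * (M.pathLik X θ z : ℝ≥0∞) *
        ((M.prop θ ϑ : ℝ≥0∞) * ∫⁻ x, f x ∂M.gridLaw ((θ, z), ϑ)) ∂lam ∂pathRef N := by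
        refine lintegral_congr fun z => ?_
        rw [M.lintegral_augment _ hf, lintegral_const_mul]
        exact hpQ.comp measurable_prodMk_left
    -- The thinning intensity involves `ϑ`, so the integral over trajectories is moved inside, where
    -- both parameters are fixed and `lintegral_thinned` applies.
    _ = ∫⁻ ϑ, ∫⁻ z, (M.prior θ : ℝ≥0∞) * M.pathDensity θ z * (M.pathLik X θ z : ℝ≥0∞) *
        ((M.prop θ ϑ : ℝ≥0∞) * ∫⁻ x, f x ∂M.gridLaw ((θ, z), ϑ)) ∂pathRef N ∂lam :=
        lintegral_lintegral_swap ((hj.comp measurable_fst).mul hpQ).aemeasurable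
    _ = _ := by
        refine lintegral_congr fun ϑ => ?_
        -- A test function of the grid alone: the sum over states then yields `gridLik`.
        have hΦ : Measurable fun p : Config × Path N => f (θ, ϑ, p.1) :=
          hf.comp (measurable_const.prodMk (measurable_const.prodMk measurable_fst))
        have hid := M.lintegral_thinned X θ ϑ hΦ
        have hR : Measurable fun z : Path N => M.pathDensity θ z * (M.pathLik X θ z : ℝ≥0∞) *
            ∫⁻ x, f x ∂M.gridLaw ((θ, z), ϑ) :=
          ((M.measurable_pathDensity.comp measurable_prodMk_left).mul
            ((M.measurable_pathLik X).comp measurable_prodMk_left).coe_nnreal_ennreal).mul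
              (hQ'.comp (measurable_id.prodMk measurable_const))
        calc _ = ∫⁻ z, (M.prior θ : ℝ≥0∞) * (M.prop θ ϑ : ℝ≥0∞) * (M.pathDensity θ z *
              (M.pathLik X θ z : ℝ≥0∞) * ∫⁻ x, f x ∂M.gridLaw ((θ, z), ϑ)) ∂pathRef N :=
              lintegral_congr fun z => by ring
          _ = (M.prior θ : ℝ≥0∞) * (M.prop θ ϑ : ℝ≥0∞) * ∫⁻ W, M.gridDensity θ ϑ W *
              ∑ v : Fin (W.1 + 1) → Fin N, (chainWeight M.init (M.B θ ϑ) (M.stepLik X θ W) W.1 v :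
                ℝ≥0∞) * f (θ, ϑ, W) ∂configRef := by
              rw [lintegral_const_mul _ hR, ← hid]
              simp only [M.lintegral_gridLaw _ hf]
          _ = _ := by
              rw [← lintegral_const_mul']
              · refine lintegral_congr fun W => ?_
                rw [← Finset.sum_mul, ← ENNReal.ofNNReal_finsetSum, ← gridLik_eq_sum, extendedDensity]
                ring
              · exact ENNReal.mul_ne_top ENNReal.coe_ne_top ENNReal.coe_ne_top

/-- The backward pass turns the extended target into the joint law of parameter, trajectory and
observations. -/
theorem extendedLaw_bind_resample [SFinite lam] :
    (M.extendedLaw X).bind (M.resample X) = M.jointLaw X := by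
  refine Measure.ext_of_lintegral _ fun f hf => ?_
  have hres : Measurable fun y => ∫⁻ x, f x ∂M.resample X y :=
    (Measure.measurable_lintegral hf).comp (M.measurable_resample X)
  rw [Measure.lintegral_bind (M.measurable_resample X).aemeasurable hf.aemeasurable,
    M.lintegral_jointLaw X hf, M.lintegral_extendedLaw X hres]
  refine lintegral_congr fun θ => ?_
  -- A test function of the trajectory alone: the Poisson integral then has mass one and disappears,
  -- and with it the dependence on `ϑ` beyond the proposal density.
  have hΦ : Measurable fun p : Config × Path N => f (θ, p.2) :=
    hf.comp (measurable_const.prodMk measurable_snd)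
  have hR : Measurable fun z : Path N => M.pathDensity θ z * (M.pathLik X θ z : ℝ≥0∞) * f (θ, z) :=
    ((M.measurable_pathDensity.comp measurable_prodMk_left).mul
      ((M.measurable_pathLik X).comp measurable_prodMk_left).coe_nnreal_ennreal).mul
        (hf.comp measurable_prodMk_left)
  have hinner : ∀ ϑ, ∫⁻ W, M.extendedDensity X (θ, ϑ, W) * ∫⁻ x, f x ∂M.resample X (θ, ϑ, W)
      ∂configRef = (M.prop θ ϑ : ℝ≥0∞) * ((M.prior θ : ℝ≥0∞) *
        ∫⁻ z, M.pathDensity θ z * (M.pathLik X θ z : ℝ≥0∞) * f (θ, z) ∂pathRef N) := by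
    intro ϑ
    have hone : ∀ z : Path N, ∫⁻ _, f (θ, z) ∂ poissonProcess (M.thinIntensity θ ϑ z) = f (θ, z) :=
      fun z => by
        have := M.isProbabilityMeasure_poissonProcess_thinIntensity θ ϑ z
        rw [lintegral_const, measure_univ, mul_one]
    have hid := M.lintegral_thinned X θ ϑ hΦ
    simp only [hone] at hid
    rw [hid, ← mul_assoc, ← lintegral_const_mul']
    · refine lintegral_congr fun W => ?_
      rw [M.lintegral_resample X _ hf, extendedDensity]
      simp only [← M.gridLik_mul_backwardProb X θ ϑ W, ENNReal.coe_mul, mul_assoc]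
      rw [← Finset.mul_sum]
      ring
    · exact ENNReal.mul_ne_top ENNReal.coe_ne_top ENNReal.coe_ne_top
  simp only [hinner]
  -- The auxiliary parameter is discarded: its density q(ϑ | θ) integrates to one.
  rw [lintegral_mul_const _ (M.measurable_prop_right θ), M.prop_int, one_mul,
    ← lintegral_const_mul _ hR]
  exact lintegral_congr fun z => by ring

/-- The acceptance probability is the Metropolis–Hastings ratio of the extended densities. -/
theorem coe_accept_eq (y : Θ × Θ × Config) (hy : M.extendedDensity X y ≠ 0) :
    (M.accept X y : ℝ≥0∞) =
      min 1 (M.extendedDensity X (swap y) / M.extendedDensity X y) := by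
  obtain ⟨θ, ϑ, W⟩ := y
  simp only [extendedDensity, swap, mul_ne_zero_iff] at hy ⊢
  obtain ⟨⟨⟨hp, hq⟩, hG⟩, hL⟩ := hy
  have hG' : M.gridDensity θ ϑ W ≠ ∞ := by
    rw [gridDensity, poissonGridDensity]
    split_ifs
    · exact ENNReal.ofReal_ne_top
    · exact ENNReal.zero_ne_top
  have hden : M.gridLik X θ ϑ W * M.prior θ * M.prop θ ϑ ≠ 0 :=
    mul_ne_zero (mul_ne_zero (ENNReal.coe_ne_zero.1 hL) (ENNReal.coe_ne_zero.1 hp))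
      (ENNReal.coe_ne_zero.1 hq)
  simp only [accept, forwardLik_eq_gridLik]
  -- By symmetry the same grid density stands in both extended densities. The acceptance ratio is
  -- expanded by it, which is legitimate since it is neither zero nor infinite here.
  rw [ENNReal.coe_min, ENNReal.coe_div hden, ENNReal.coe_one, M.gridDensity_comm ϑ θ W,
    ← ENNReal.mul_div_mul_right _ _ hG hG']
  push_cast
  congr 2 <;> ring

theorem extendedDensity_ne_top (y : Θ × Θ × Config) : M.extendedDensity X y ≠ ∞ := by
  rw [extendedDensity, gridDensity, poissonGridDensity]
  split_ifs
  · exact ENNReal.mul_ne_top (ENNReal.mul_ne_top (ENNReal.mul_ne_top ENNReal.coe_ne_top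
      ENNReal.coe_ne_top) ENNReal.ofReal_ne_top) ENNReal.coe_ne_top
  · simp

/-- Detailed balance: the flow out of `y` through accepted swaps is symmetric in `y` and `swap y`.
Where the density is zero, the value of `accept` is irrelevant. -/
theorem extendedDensity_mul_accept (y : Θ × Θ × Config) :
    M.extendedDensity X y * M.accept X y =
      min (M.extendedDensity X y) (M.extendedDensity X (swap y)) := by
  by_cases hy : M.extendedDensity X y = 0
  · rw [hy, zero_mul, min_eq_left zero_le]
  · rw [M.coe_accept_eq X y hy, mul_min, mul_one,
      ENNReal.mul_div_cancel hy (M.extendedDensity_ne_top X y)]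

/-- Both parameters have the same reference measure, so this is Tonelli. -/
theorem lintegral_comp_swap [SFinite lam] {f : Θ × Θ × Config → ℝ≥0∞} (hf : Measurable f) :
    ∫⁻ y, f (swap y) ∂lam.prod (lam.prod configRef) =
      ∫⁻ y, f y ∂lam.prod (lam.prod configRef) := by
  have hs : Measurable fun y : Θ × Θ × Config => f (swap y) := hf.comp measurable_swap_params
  have hf' : Measurable fun p : Θ × Θ => ∫⁻ W, f (p.1, p.2, W) ∂configRef := by
    have : Measurable fun q : (Θ × Θ) × Config => f (q.1.1, q.1.2, q.2) :=
      hf.comp (measurable_fst.fst.prodMk (measurable_fst.snd.prodMk measurable_snd))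
    exact this.lintegral_prod_right'
  have h1 : ∫⁻ y, f (swap y) ∂lam.prod (lam.prod configRef) =
      ∫⁻ θ, ∫⁻ ϑ, ∫⁻ W, f (ϑ, θ, W) ∂configRef ∂lam ∂lam := by
    rw [lintegral_prod _ hs.aemeasurable]
    exact lintegral_congr fun θ => lintegral_prod _ (hs.comp measurable_prodMk_left).aemeasurable
  have h2 : ∫⁻ y, f y ∂lam.prod (lam.prod configRef) =
      ∫⁻ θ, ∫⁻ ϑ, ∫⁻ W, f (θ, ϑ, W) ∂configRef ∂lam ∂lam := by
    rw [lintegral_prod _ hf.aemeasurable]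
    exact lintegral_congr fun θ => lintegral_prod _ (hf.comp measurable_prodMk_left).aemeasurable
  rw [h1, h2]
  exact (lintegral_lintegral_swap hf'.aemeasurable).symm

/-- The swap move leaves the extended target invariant. -/
theorem extendedLaw_bind_mhStep [SFinite lam] :
    (M.extendedLaw X).bind (M.mhStep X) = M.extendedLaw X := by
  refine Measure.ext_of_lintegral _ fun f hf => ?_
  have hmh : Measurable fun y => ∫⁻ x, f x ∂M.mhStep X y :=
    (Measure.measurable_lintegral hf).comp (M.measurable_mhStep X)
  have hg := M.measurable_extendedDensity X
  have ha := M.measurable_accept X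
  rw [Measure.lintegral_bind (M.measurable_mhStep X).aemeasurable hf.aemeasurable, extendedLaw,
    lintegral_withDensity_eq_lintegral_mul _ hg hmh, lintegral_withDensity_eq_lintegral_mul _ hg hf]
  have hmin : Measurable fun y => min (M.extendedDensity X y) (M.extendedDensity X (swap y)) :=
    hg.min (hg.comp measurable_swap_params)
  have h1 : Measurable fun y => min (M.extendedDensity X y) (M.extendedDensity X (swap y)) *
      f (swap y) := hmin.mul (hf.comp measurable_swap_params)
  have h2 : Measurable fun y => min (M.extendedDensity X y) (M.extendedDensity X (swap y)) * f y :=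
    hmin.mul hf
  calc _ = ∫⁻ y, min (M.extendedDensity X y) (M.extendedDensity X (swap y)) * f (swap y) +
        M.extendedDensity X y * ((1 - M.accept X y : ℝ≥0) : ℝ≥0∞) * f y
        ∂lam.prod (lam.prod configRef) := by
        refine lintegral_congr fun y => ?_
        rw [Pi.mul_apply, M.lintegral_mhStep X y hf, mul_add, ← mul_assoc,
          M.extendedDensity_mul_accept, ← mul_assoc]
    -- The mass arriving at `y` by accepted swaps replaces the mass that left it; acceptance and
    -- rejection at `y` then add up to one.
    _ = ∫⁻ y, min (M.extendedDensity X y) (M.extendedDensity X (swap y)) * f y +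
        M.extendedDensity X y * ((1 - M.accept X y : ℝ≥0) : ℝ≥0∞) * f y
        ∂lam.prod (lam.prod configRef) := by
        rw [lintegral_add_left h1, lintegral_add_left h2, ← lintegral_comp_swap h2]
        congr 1
        refine lintegral_congr fun y => ?_
        rw [min_comm]
        rfl
    _ = _ := by
        refine lintegral_congr fun y => ?_
        rw [← M.extendedDensity_mul_accept, ← add_mul, ← mul_add, ← ENNReal.coe_add,
          add_tsub_cancel_of_le (M.accept_le_one X y), ENNReal.coe_one, mul_one, Pi.mul_apply]

theorem posterior_bind_augment [SFinite lam] :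
    (M.posterior X).bind M.augment = (M.evidence X)⁻¹ • M.extendedLaw X := by
  rw [posterior, Measure.bind_smul, jointLaw_bind_augment]

theorem posterior_bind_step [SFinite lam] : (M.posterior X).bind (M.step X) = M.posterior X := by
  have h : (M.posterior X).bind (M.step X) =
      (((M.posterior X).bind M.augment).bind (M.mhStep X)).bind (M.resample X) := by
    have haug : Measurable fun y => (M.augment y).bind (M.mhStep X) :=
      (Measure.measurable_bind' (M.measurable_mhStep X)).comp M.measurable_augment
    rw [Measure.bind_bind M.measurable_augment.aemeasurable (M.measurable_mhStep X).aemeasurable,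
      Measure.bind_bind haug.aemeasurable (M.measurable_resample X).aemeasurable]
    rfl
  rw [h, posterior_bind_augment, Measure.bind_smul, extendedLaw_bind_mhStep, Measure.bind_smul,
    extendedLaw_bind_resample, posterior]

end Target

end Model

end SymMH

/-- Stationarity of the symmetrized Metropolis–Hastings sampler. -/
theorem mainTheorem2 {N m : ℕ} {Θ 𝒳 : Type*} [MeasurableSpace Θ] (lam : Measure Θ)
    [SigmaFinite lam] (M : SymMH.Model N m Θ 𝒳 lam) (X : Fin m → 𝒳)
    (hX0 : M.evidence X ≠ 0) (hX1 : M.evidence X ≠ ∞) :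
    -- one iteration is a Markov kernel that leaves the posterior invariant
    (∃ K : Kernel (Θ × SymMH.Path N) (Θ × SymMH.Path N),
      (∀ y, K y = M.step X y) ∧ IsMarkovKernel K ∧ K.Invariant (M.posterior X)) ∧
    -- `P(W | θ, ϑ)` is the density of the Poisson process of rate `Ω(θ) + Ω(ϑ)` on `[0, tEnd]`
    (∀ θ ϑ : Θ,
      (SymMH.poissonProcess
          (ENNReal.ofReal (M.gridRate θ ϑ) • volume.restrict (Set.Icc 0 M.tEnd))).map
          (fun u => SymMH.gridOf (SymMH.pts u.2)) =
        SymMH.configRef.withDensity (M.gridDensity θ ϑ)) ∧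
    -- it is symmetric in the two parameters
    (∀ (θ ϑ : Θ) (W : SymMH.Config), M.gridDensity θ ϑ W = M.gridDensity ϑ θ W) ∧
    -- law of `(θ, ϑ, W)` when the swap is proposed in stationarity
    (M.posterior X).bind M.augment =
      (M.evidence X)⁻¹ •
        (lam.prod (lam.prod SymMH.configRef)).withDensity (M.extendedDensity X) ∧
    -- the acceptance probability, in which the grid density does not occur, is the
    -- Metropolis–Hastings acceptance probability of the swap for this law
    (∀ᵐ y ∂((M.posterior X).bind M.augment),
      (M.accept X y : ℝ≥0∞) =
        min 1 (M.extendedDensity X (SymMH.Model.swap y) / M.extendedDensity X y)) := by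
  refine ⟨⟨⟨M.step X, M.measurable_step X⟩, fun y => rfl, ⟨M.isProbabilityMeasure_step X⟩,
    M.posterior_bind_step X⟩, fun θ ϑ => ?_, M.gridDensity_comm, M.posterior_bind_augment X, ?_⟩
  · exact SymMH.map_gridOf_poissonProcess_const M.tEnd_pos (M.gridRate_nonneg θ ϑ)
  · rw [M.posterior_bind_augment X]
    refine Measure.ae_smul_measure ?_ _
    -- Almost every point of a measure with density g satisfies g ≠ 0, which is all that
    -- `coe_accept_eq` needs.
    rw [SymMH.Model.extendedLaw, ae_withDensity_iff (M.measurable_extendedDensity X)]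
    exact Filter.Eventually.of_forall fun y hy => M.coe_accept_eq X y hy
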